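/- For complex numbers $a,q$ with $|q|<1$ and an integer $n\ge 0$ write $(a;q)_n=\prod_{k=0}^{n-1}(1-aq^k)$ and $(a;q)_\infty=\prod_{k=0}^{\infty}(1-aq^k)$. Let $q\in\mathbb{C}$ with $|q|<1$. Then all series below converge, and (1) $$\sum_{n=0}^{\infty}\frac{(-q;q^2)_n\,q^{n^2}}{(1-q^{2n+1})\,(q^2;q^2)_n^2}=\frac{(-q;q^2)_\infty}{(q^2;q^2)_\infty}\left(1+\sum_{r=0}^\infty q^{8r^2+4r+1}(1-q^{8r+4})\right),$$ (2) $$\sum_{n=0}^{\infty}\frac{q^{n^2+n}}{(1-q^{2n+1})\,(q;q)_n^2}=\frac{1}{(q;q)_\infty}\sum_{r=0}^\infty q^{6r^2+2r}(1-q^{8r+4}),$$ (3) $$\sum_{n=0}^{\infty}\frac{q^{n^2+2n}}{(1-q^{2n+1})\,(q;q)_n^2}=\frac{1}{(q;q)_\infty}\sum_{r=0}^\infty q^{6r^2+4r}(1-q^{4r+2}),$$ (4) $$\sum_{n=0}^{\infty}\frac{(-q;q)_n\,q^{(n^2+n)/2}}{(1-q^{2n+1})\,(q;q)_n^2}=\frac{(-q;q)_\infty}{(q;q)_\infty}\sum_{r=0}^\infty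 q^{4r^2+r}(1-q^{6r+3}),$$ (5) $$\sum_{n=0}^{\infty}\frac{(-q;q)_n\,q^{(n^2+3n)/2}}{(1-q^{2n+1})\,(q;q)_n^2}=\frac{(-q;q)_\infty}{(q;q)_\infty}\sum_{r=0}^\infty q^{4r^2+3r}(1-q^{2r+1}),$$ (6) $$\sum_{n=0}^{\infty}\frac{q^{n^2+2n}}{(1-q^{2n+1})\,(q^2;q^2)_n}=(-q;q^2)_\infty\sum_{r=0}^\infty(-1)^r q^{6r^2+4r}(1+q^{4r+2}),$$ and, if moreover $q\neq 0$, (7) $$\sum_{n=0}^{\infty}\frac{(-q;q^2)_{n+1}\,q^{n^2-2n}}{(q^2;q^2)_n\,(q^2;q^2)_{n+1}}=\frac{(-q;q^2)_\infty}{(q^2;q^2)_\infty}\left[1+q+q^2+q^3+\sum_{r=0}^\infty q^{r^2}\left(q^{-2r}-q^{2r}\right)\right].$$ -/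

import Mathlib

/-- The finite `q`-shifted factorial `(a;q)_n = (1-a)(1-aq)⋯(1-aq^{n-1})`. -/
noncomputable def qPoch (a q : ℂ) (n : ℕ) : ℂ :=
  ∏ k ∈ Finset.range n, (1 - a * q ^ k)

/-- The infinite `q`-shifted factorial `(a;q)_∞ = (1-a)(1-aq)(1-aq^2)⋯`, for `|q| < 1`. -/
noncomputable def qPochInf (a q : ℂ) : ℂ :=
  ∏' k : ℕ, (1 - a * q ^ k)

/-- The infinite product defining `(a;q)_∞` converges for `|q| < 1`. -/
theorem multipliable_qPochInf (a q : ℂ) (hq : ‖q‖ < 1) :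
    Multipliable fun k : ℕ => 1 - a * q ^ k := by
  have h : Summable fun k : ℕ => ‖-(a * q ^ k)‖ := by
    simp only [norm_neg, norm_mul, norm_pow]
    exact (summable_geometric_of_lt_one (norm_nonneg q) hq).mul_left _
  simpa only [sub_eq_add_neg] using multipliable_one_add_of_summable h

open Filter Topology

/-! ### Basic facts on `q`-shifted factorials -/

/-! Identities (1) to (5) come from the Bailey transform. Put `K(n,r) = 1/((q;q)_{n-r}
(q;q)_{n+r+e})`. If `β_n = ∑_r α_r K(n,r)` has a closed form and `γ_r = ∑_n δ_n K(n,r)` can be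
summed, then interchanging the sums gives `∑ δ_n β_n = ∑ α_r γ_r`. The weights `δ_n` are those of
the confluent `q`-Gauss sum `tsum_qGaussTerm`, so `γ_r` is an infinite product up to an explicit
factor (`hasSum_qWeight_mul_baileyKernel`).

The closed forms all stem from one Bailey pair in base `q²`, `sum_baileyKernel`, proved by creative
telescoping. Replacing `q` by `-q` and taking half the sum and half the difference splits it into
two pairs in base `q`, with coefficients `evenAlpha` and `oddAlpha`. The choices `y = 0` and `y =
-q` with these pairs give (2) to (5), once the terms `2k` and `2k+1` are grouped. Identity (1) uses
the unsplit pair. Its weights belong to `e = 0` while the pair has `e = 1`, and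
`baileyKernel_zero_sub` bridges the gap.

Identity (7) needs no Bailey pair: its left side is a combination of two `q`-Gauss sums and the
series on its right telescopes. For (6), expanding `1/(1-q^{2n+1})` geometrically and summing over
`n` by Euler leaves `∑ q^k/(-q;q²)_{k+1}`. Two first-order recurrences in a shift parameter turn
this into Rogers' false theta series in base `q²` (`tsum_fineTerm_zero`,
`tsum_falseThetaTerm_zero`). -/

theorem qPoch_zero (a q : ℂ) : qPoch a q 0 = 1 := by simp [qPoch]

theorem qPoch_succ (a q : ℂ) (n : ℕ) : qPoch a q (n + 1) = qPoch a q n * (1 - a * q ^ n) := by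
  simp [qPoch, Finset.prod_range_succ]

theorem qPoch_self_succ (q : ℂ) (n : ℕ) : qPoch q q (n + 1) = qPoch q q n * (1 - q ^ (n + 1)) := by
  rw [qPoch_succ, pow_succ' q n]

theorem qPoch_succ' (a q : ℂ) (n : ℕ) : qPoch a q (n + 1) = (1 - a) * qPoch (a * q) q n := by
  simp only [qPoch, Finset.prod_range_succ', pow_zero, mul_one]
  rw [mul_comm]
  congr 1
  exact Finset.prod_congr rfl fun k _ => by ring

theorem one_sub_pow_ne_zero {q : ℂ} (hq : ‖q‖ < 1) {n : ℕ} (hn : n ≠ 0) : 1 - q ^ n ≠ 0 := by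
  intro h
  have h1 : ‖q ^ n‖ = 1 := by rw [← sub_eq_zero.1 h]; simp
  rw [norm_pow] at h1
  exact (pow_lt_one₀ (norm_nonneg q) hq hn).ne h1

theorem one_sub_ne_zero_of_norm_lt {x : ℂ} (hx : ‖x‖ < 1) : 1 - x ≠ 0 := by
  simpa using one_sub_pow_ne_zero hx one_ne_zero

theorem norm_pow_lt_one {q : ℂ} (hq : ‖q‖ < 1) {n : ℕ} (hn : n ≠ 0) : ‖q ^ n‖ < 1 := by
  rw [norm_pow]
  exact pow_lt_one₀ (norm_nonneg q) hq hn

theorem qPoch_ne_zero {a q : ℂ} (ha : ‖a‖ < 1) (hq : ‖q‖ < 1) (n : ℕ) : qPoch a q n ≠ 0 := by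
  refine Finset.prod_ne_zero_iff.2 fun k _ => one_sub_ne_zero_of_norm_lt ?_
  rw [norm_mul, norm_pow]
  exact mul_lt_one_of_nonneg_of_lt_one_left (norm_nonneg a) ha
    (pow_le_one₀ (norm_nonneg q) hq.le)

theorem qPochInf_eq_qPoch_mul (a : ℂ) {q : ℂ} (hq : ‖q‖ < 1) (n : ℕ) :
    qPochInf a q = qPoch a q n * qPochInf (a * q ^ n) q := by
  have e : (fun k : ℕ => 1 - a * q ^ (k + n)) = fun k => 1 - a * q ^ n * q ^ k := by
    funext k; ring
  have h : Multipliable fun k : ℕ => 1 - a * q ^ (k + n) := by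
    rw [e]; exact multipliable_qPochInf (a * q ^ n) q hq
  have h' := Multipliable.prod_mul_tprod_nat_mul' (f := fun k : ℕ => 1 - a * q ^ k) h
  rw [e] at h'
  exact h'.symm

theorem qPochInf_eq_one_sub_mul (a : ℂ) {q : ℂ} (hq : ‖q‖ < 1) :
    qPochInf a q = (1 - a) * qPochInf (a * q) q := by
  simpa [qPoch] using qPochInf_eq_qPoch_mul a hq 1

theorem qPochInf_zero (q : ℂ) : qPochInf 0 q = 1 := by simp [qPochInf]

theorem summable_norm_mul_pow (a : ℂ) {q : ℂ} (hq : ‖q‖ < 1) :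
    Summable fun k : ℕ => ‖-(a * q ^ k)‖ := by
  simp only [norm_neg, norm_mul, norm_pow]
  exact (summable_geometric_of_lt_one (norm_nonneg q) hq).mul_left _

theorem qPochInf_ne_zero {a q : ℂ} (ha : ‖a‖ < 1) (hq : ‖q‖ < 1) : qPochInf a q ≠ 0 := by
  have := tprod_one_add_ne_zero_of_summable (f := fun k : ℕ => -(a * q ^ k)) (fun k => ?_)
    (summable_norm_mul_pow a hq)
  · simp only [← sub_eq_add_neg] at this
    exact this
  · rw [← sub_eq_add_neg]
    apply one_sub_ne_zero_of_norm_lt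
    rw [norm_mul, norm_pow]
    exact mul_lt_one_of_nonneg_of_lt_one_left (norm_nonneg a) ha
      (pow_le_one₀ (norm_nonneg q) hq.le)

theorem norm_qPoch_sub_one_le (a : ℂ) {q : ℂ} (hq : ‖q‖ < 1) (n : ℕ) :
    ‖qPoch a q n - 1‖ ≤ Real.exp (‖a‖ * (1 - ‖q‖)⁻¹) - 1 := by
  have h1 := Finset.norm_prod_one_add_sub_one_le (Finset.range n) fun k : ℕ => -(a * q ^ k)
  have h2 : ∑ k ∈ Finset.range n, ‖-(a * q ^ k)‖ ≤ ‖a‖ * (1 - ‖q‖)⁻¹ := by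
    refine ((summable_norm_mul_pow a hq).sum_le_tsum _ fun _ _ => norm_nonneg _).trans ?_
    simp only [norm_neg, norm_mul, norm_pow]
    rw [tsum_mul_left, tsum_geometric_of_lt_one (norm_nonneg q) hq]
  simp only [← sub_eq_add_neg] at h1
  change ‖qPoch a q n - 1‖ ≤ _ at h1
  have h4 := Real.exp_le_exp.2 h2
  linarith

theorem norm_qPoch_le (a : ℂ) {q : ℂ} (hq : ‖q‖ < 1) (n : ℕ) :
    ‖qPoch a q n‖ ≤ Real.exp (‖a‖ * (1 - ‖q‖)⁻¹) := by
  have h1 := norm_qPoch_sub_one_le a hq n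
  have h3 := norm_le_norm_sub_add (qPoch a q n) 1
  rw [norm_one] at h3
  linarith

theorem tendsto_qPoch (a : ℂ) {q : ℂ} (hq : ‖q‖ < 1) :
    Tendsto (qPoch a q) atTop (𝓝 (qPochInf a q)) :=
  (multipliable_qPochInf a q hq).tendsto_prod_tprod_nat

theorem norm_qPochInf_le (a : ℂ) {q : ℂ} (hq : ‖q‖ < 1) :
    ‖qPochInf a q‖ ≤ Real.exp (‖a‖ * (1 - ‖q‖)⁻¹) :=
  le_of_tendsto (tendsto_qPoch a hq).norm (Eventually.of_forall fun n => norm_qPoch_le a hq n)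

theorem tendsto_qPochInf_mul_pow (a : ℂ) {q : ℂ} (hq : ‖q‖ < 1) :
    Tendsto (fun N : ℕ => qPochInf (a * q ^ N) q) atTop (𝓝 1) := by
  have h1 : Tendsto (fun N : ℕ => Real.exp (‖a * q ^ N‖ * (1 - ‖q‖)⁻¹) - 1) atTop (𝓝 0) := by
    have h := (tendsto_pow_atTop_nhds_zero_of_norm_lt_one hq).const_mul a
    have h' := (Real.continuous_exp.tendsto _).comp (h.norm.mul_const (1 - ‖q‖)⁻¹)
    simpa using h'.sub_const 1
  rw [tendsto_iff_norm_sub_tendsto_zero]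
  refine squeeze_zero (fun N => norm_nonneg _) (fun N => ?_) h1
  exact le_of_tendsto ((tendsto_qPoch (a * q ^ N) hq).sub_const 1).norm
    (Eventually.of_forall fun n => norm_qPoch_sub_one_le _ hq n)

theorem norm_qPochInf_le_of_le {a q : ℂ} {A : ℝ} (ha : ‖a‖ ≤ A) (hq : ‖q‖ < 1) :
    ‖qPochInf a q‖ ≤ Real.exp (A * (1 - ‖q‖)⁻¹) := by
  refine (norm_qPochInf_le a hq).trans (Real.exp_le_exp.2 ?_)
  have : 0 < 1 - ‖q‖ := by linarith
  gcongr

/-- The reciprocal `1 / (q;q)_n` as an infinite product. -/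
theorem inv_qPoch_self {q : ℂ} (hq : ‖q‖ < 1) (n : ℕ) :
    (qPoch q q n)⁻¹ = qPochInf (q ^ (n + 1)) q / qPochInf q q := by
  rw [qPochInf_eq_qPoch_mul q hq n, ← pow_succ']
  have h1 := qPoch_ne_zero hq hq n
  have h2 : qPochInf (q ^ (n + 1)) q ≠ 0 :=
    qPochInf_ne_zero (norm_pow_lt_one hq n.succ_ne_zero) hq
  field_simp

theorem exists_norm_inv_qPoch_self_le {q : ℂ} (hq : ‖q‖ < 1) :
    ∃ C : ℝ, 0 < C ∧ ∀ n, ‖(qPoch q q n)⁻¹‖ ≤ C := by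
  have h0 : 0 < ‖qPochInf q q‖ := norm_pos_iff.2 (qPochInf_ne_zero hq hq)
  refine ⟨Real.exp (1 * (1 - ‖q‖)⁻¹) / ‖qPochInf q q‖, by positivity, fun n => ?_⟩
  rw [inv_qPoch_self hq, norm_div]
  gcongr
  exact norm_qPochInf_le_of_le (norm_pow_lt_one hq n.succ_ne_zero).le hq

/-! ### Triangular exponents -/

theorem choose_two_succ (n : ℕ) : (n + 1).choose 2 = n.choose 2 + n := by
  rw [Nat.choose_succ_succ' n 1, Nat.choose_one_right, add_comm]

theorem two_mul_choose_two_add (n : ℕ) : 2 * n.choose 2 + n = n ^ 2 := by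
  induction n with
  | zero => rfl
  | succ n ih => rw [choose_two_succ]; linarith

theorem summable_pow_choose_two_mul_pow {t : ℝ} (ht0 : 0 ≤ t) (ht : t < 1) (K : ℝ) :
    Summable fun m : ℕ => t ^ m.choose 2 * K ^ m := by
  have h : Tendsto (fun m : ℕ => t ^ m * |K|) atTop (𝓝 0) := by
    simpa using (tendsto_pow_atTop_nhds_zero_of_lt_one ht0 ht).mul_const |K|
  refine summable_of_ratio_norm_eventually_le (r := 1 / 2) (by norm_num) ?_
  filter_upwards [h.eventually (ge_mem_nhds (show (0 : ℝ) < 1 / 2 by norm_num))] with m hm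
  have : t ^ (m + 1).choose 2 * K ^ (m + 1) = t ^ m * K * (t ^ m.choose 2 * K ^ m) := by
    rw [choose_two_succ]; ring
  rw [this, norm_mul]
  refine mul_le_mul_of_nonneg_right ?_ (norm_nonneg _)
  simpa [abs_of_nonneg ht0] using hm

theorem summable_succ_mul_pow_choose_two_mul_pow {t : ℝ} (ht0 : 0 ≤ t) (ht : t < 1) {K : ℝ}
    (hK : 0 ≤ K) : Summable fun m : ℕ => ((m : ℝ) + 1) * (t ^ m.choose 2 * K ^ m) := by
  refine (summable_pow_choose_two_mul_pow ht0 ht (2 * K)).of_nonneg_of_le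
    (fun m => by positivity) fun m => ?_
  -- The linear factor is absorbed by doubling `K`, which is harmless since the exponent `m.choose
  -- 2` is quadratic.
  have h : (m : ℝ) + 1 ≤ 2 ^ m := by exact_mod_cast Nat.lt_two_pow_self
  calc _ ≤ 2 ^ m * (t ^ m.choose 2 * K ^ m) := by gcongr
    _ = _ := by rw [mul_pow]; ring

/-! ### A confluent form of the `q`-Gauss sum -/

/-- The weights `(-1)^n q^{n(n-1)/2} (y - c)(y - cq)⋯(y - cq^{n-1})`. -/
noncomputable def qWeight (q y c : ℂ) (n : ℕ) : ℂ :=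
  (-1) ^ n * q ^ n.choose 2 * ∏ k ∈ Finset.range n, (y - c * q ^ k)

theorem qWeight_zero (q y c : ℂ) : qWeight q y c 0 = 1 := by simp [qWeight]

theorem qWeight_succ (q y c : ℂ) (n : ℕ) :
    qWeight q y c (n + 1) = -q ^ n * (y - c * q ^ n) * qWeight q y c n := by
  simp only [qWeight, Finset.prod_range_succ, choose_two_succ]
  ring

theorem qWeight_mul_pow (q y c s : ℂ) (n : ℕ) :
    qWeight q (y * s) (c * s) n = s ^ n * qWeight q y c n := by
  induction n with
  | zero => simp [qWeight_zero]
  | succ n ih => rw [qWeight_succ, qWeight_succ, ih]; ring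

theorem qWeight_add (q y c : ℂ) (m r : ℕ) :
    qWeight q y c (m + r) = qWeight q y c r * qWeight q (y * q ^ r) (c * q ^ (2 * r)) m := by
  induction m with
  | zero => simp [qWeight_zero]
  | succ m ih =>
    rw [show m + 1 + r = m + r + 1 by ring, qWeight_succ, ih, qWeight_succ]
    ring

theorem norm_qWeight_le {q y c : ℂ} (hq : ‖q‖ < 1) (n : ℕ) :
    ‖qWeight q y c n‖ ≤ ‖q‖ ^ n.choose 2 * (‖y‖ + ‖c‖) ^ n := by
  rw [qWeight, norm_mul, norm_mul, norm_pow, norm_pow, norm_neg, norm_one, one_pow, one_mul]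
  gcongr
  rw [norm_prod]
  refine (Finset.prod_le_prod (g := fun _ => ‖y‖ + ‖c‖) (fun k _ => norm_nonneg _)
    fun k _ => ?_).trans_eq (by simp)
  refine (norm_sub_le _ _).trans ?_
  rw [norm_mul, norm_pow]
  gcongr
  exact mul_le_of_le_one_right (norm_nonneg c) (pow_le_one₀ (norm_nonneg q) hq.le)

theorem summable_succ_mul_norm_qWeight {q : ℂ} (hq : ‖q‖ < 1) (y c : ℂ) :
    Summable fun n : ℕ => ((n : ℝ) + 1) * ‖qWeight q y c n‖ := by
  refine (summable_succ_mul_pow_choose_two_mul_pow (norm_nonneg q) hq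
    (K := ‖y‖ + ‖c‖) (by positivity)).of_nonneg_of_le (fun n => by positivity) fun n => ?_
  gcongr
  exact norm_qWeight_le hq n

/-- The summand of the confluent `q`-Gauss sum, cleared of the denominator `(c;q)_m`. -/
noncomputable def qGaussTerm (q y c : ℂ) (m : ℕ) : ℂ :=
  qWeight q y c m * (qPochInf (c * q ^ m) q / qPoch q q m)

theorem exists_norm_qGaussTerm_le {q : ℂ} (hq : ‖q‖ < 1) (y c : ℂ) :
    ∃ u : ℕ → ℝ, Summable u ∧
      ∀ N m, ‖qGaussTerm q (y * q ^ N) (c * q ^ N) m‖ ≤ u m := by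
  obtain ⟨C, hC, hCle⟩ := exists_norm_inv_qPoch_self_le hq
  refine ⟨fun m => ‖q‖ ^ m.choose 2 * (‖y‖ + ‖c‖) ^ m * (Real.exp (‖c‖ * (1 - ‖q‖)⁻¹) * C),
    (summable_pow_choose_two_mul_pow (norm_nonneg q) hq _).mul_right _, fun N m => ?_⟩
  have hpow : ∀ k : ℕ, ‖q ^ k‖ ≤ 1 := fun k => by
    rw [norm_pow]; exact pow_le_one₀ (norm_nonneg q) hq.le
  rw [qGaussTerm, norm_mul, div_eq_mul_inv, norm_mul]
  dsimp only
  gcongr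
  · rw [qWeight_mul_pow, norm_mul, norm_pow]
    calc _ ≤ 1 * ‖qWeight q y c m‖ := by gcongr; exact pow_le_one₀ (norm_nonneg _) (hpow N)
      _ ≤ _ := by rw [one_mul]; exact norm_qWeight_le hq m
  · refine norm_qPochInf_le_of_le ?_ hq
    rw [mul_assoc, ← pow_add, norm_mul]
    exact mul_le_of_le_one_right (norm_nonneg c) (hpow _)
  · exact hCle m

theorem summable_qGaussTerm {q : ℂ} (hq : ‖q‖ < 1) (y c : ℂ) : Summable (qGaussTerm q y c) := by
  obtain ⟨u, hu, h⟩ := exists_norm_qGaussTerm_le hq y c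
  exact Summable.of_norm_bounded hu fun m => by simpa using h 0 m

/-- Telescoping certificate for the contiguous relation `S(y,c) = (1-y) S(yq,cq)`. The factor `1 -
q^m` kills the boundary term at `m = 0`. -/
theorem qGaussTerm_sub {q : ℂ} (hq : ‖q‖ < 1) (y c : ℂ) (m : ℕ) :
    qGaussTerm q y c m - (1 - y) * qGaussTerm q (y * q) (c * q) m =
      (1 - q ^ m) * qGaussTerm q y c m - (1 - q ^ (m + 1)) * qGaussTerm q y c (m + 1) := by
  have h1 := qPoch_ne_zero hq hq m
  have h2 := one_sub_pow_ne_zero hq m.succ_ne_zero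
  simp only [qGaussTerm, qWeight_mul_pow, qWeight_succ, qPoch_self_succ]
  rw [qPochInf_eq_one_sub_mul (c * q ^ m) hq, show c * q * q ^ m = c * q ^ m * q by ring,
    show c * q ^ (m + 1) = c * q ^ m * q by ring]
  field_simp
  ring

theorem tsum_qGaussTerm_eq {q : ℂ} (hq : ‖q‖ < 1) (y c : ℂ) :
    ∑' m, qGaussTerm q y c m = (1 - y) * ∑' m, qGaussTerm q (y * q) (c * q) m := by
  have hs := summable_qGaussTerm hq y c
  have hs' := summable_qGaussTerm hq (y * q) (c * q)
  have hR : Summable fun m => (1 - q ^ m) * qGaussTerm q y c m := by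
    refine Summable.of_norm_bounded (hs.norm.mul_left 2) fun m => ?_
    rw [norm_mul]
    gcongr
    refine (norm_sub_le _ _).trans ?_
    rw [norm_one, norm_pow]
    linarith [pow_le_one₀ (norm_nonneg q) hq.le (n := m)]
  have h := hR.tsum_eq_zero_add
  have h' := (summable_nat_add_iff 1).2 hR
  rw [← sub_eq_zero, ← tsum_mul_left, ← hs.tsum_sub (hs'.mul_left _)]
  simp only [qGaussTerm_sub hq]
  rw [hR.tsum_sub h', h]
  simp

/-- This is the `₁φ₁` sum with argument `c/a`, written with `y = c/a`. The terms are then polynomial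
in `y` apart from the factor in `c`, so `y = 0` (that is, `a → ∞`) and `c = 0` need no separate
limit. -/
theorem tsum_qGaussTerm {q : ℂ} (hq : ‖q‖ < 1) (y c : ℂ) :
    ∑' m, qGaussTerm q y c m = qPochInf y q := by
  have hiter : ∀ N : ℕ, ∑' m, qGaussTerm q y c m =
      qPoch y q N * ∑' m, qGaussTerm q (y * q ^ N) (c * q ^ N) m := by
    intro N
    induction N with
    | zero => simp [qPoch_zero]
    | succ N ih =>
      rw [ih, tsum_qGaussTerm_eq hq, qPoch_succ, pow_succ]
      simp only [mul_assoc]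
  obtain ⟨u, hu, hle⟩ := exists_norm_qGaussTerm_le hq y c
  -- By homogeneity of the weights the `m`-th term carries `q^{Nm}`, so only `m = 0` survives as `N
  -- → ∞`.
  have hlim : Tendsto (fun N => ∑' m, qGaussTerm q (y * q ^ N) (c * q ^ N) m) atTop
      (𝓝 (∑' m : ℕ, if m = 0 then 1 else 0)) := by
    refine tendsto_tsum_of_dominated_convergence hu (fun m => ?_)
      (Eventually.of_forall fun N m => hle N m)
    have h1 : Tendsto (fun N : ℕ => qPochInf (c * q ^ N * q ^ m) q) atTop (𝓝 1) :=
      (tendsto_qPochInf_mul_pow (c * q ^ m) hq).congr fun N => by rw [mul_right_comm]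
    simp only [qGaussTerm, qWeight_mul_pow]
    rcases eq_or_ne m 0 with rfl | hm
    · simpa [qPoch_zero, qWeight_zero] using h1
    · have h0 : Tendsto (fun N : ℕ => (q ^ N) ^ m) atTop (𝓝 0) := by
        refine (tendsto_pow_atTop_nhds_zero_of_norm_lt_one (norm_pow_lt_one hq hm)).congr
          fun N => ?_
        rw [← pow_mul, ← pow_mul, mul_comm]
      simpa [hm] using (h0.mul_const (qWeight q y c m)).mul (h1.div_const (qPoch q q m))
  rw [tsum_ite_eq] at hlim
  have h2 := (tendsto_qPoch y hq).mul hlim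
  rw [mul_one] at h2
  exact tendsto_nhds_unique (tendsto_const_nhds.congr hiter) h2

/-! ### The Bailey transform -/

/-- The kernel `1 / ((q;q)_{n-r} (q;q)_{n+r+e})`, zero for `r > n`. -/
noncomputable def baileyKernel (q : ℂ) (e n r : ℕ) : ℂ :=
  if r ≤ n then (qPoch q q (n - r) * qPoch q q (n + r + e))⁻¹ else 0

theorem baileyKernel_of_lt (q : ℂ) (e : ℕ) {n r : ℕ} (h : n < r) : baileyKernel q e n r = 0 :=
  if_neg (not_le.2 h)

theorem baileyKernel_add (q : ℂ) (e m r : ℕ) :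
    baileyKernel q e (m + r) r = (qPoch q q m * qPoch q q (m + 2 * r + e))⁻¹ := by
  rw [baileyKernel, if_pos (Nat.le_add_left r m), Nat.add_sub_cancel, two_mul, ← add_assoc m r r]

theorem exists_norm_baileyKernel_le {q : ℂ} (hq : ‖q‖ < 1) (e : ℕ) :
    ∃ C : ℝ, 0 < C ∧ ∀ n r, ‖baileyKernel q e n r‖ ≤ C := by
  obtain ⟨C, hC, h⟩ := exists_norm_inv_qPoch_self_le hq
  refine ⟨C * C, by positivity, fun n r => ?_⟩
  rw [baileyKernel]
  split_ifs
  · rw [mul_inv, norm_mul]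
    exact mul_le_mul (h _) (h _) (norm_nonneg _) hC.le
  · rw [norm_zero]
    positivity

theorem HasSum.congr_of_eq {f g : ℕ → ℂ} {a b : ℂ} (h : HasSum f a) (hfg : ∀ n, g n = f n)
    (hab : b = a) : HasSum g b := by
  rwa [hab, funext hfg]

/-- Substituting `n = m + r` factors the weight by `qWeight_add`, and `1/(q;q)_{m+2r+e}` becomes a
quotient of infinite products. What remains is the `q`-Gauss sum with parameters `y q^r` and
`q^{e+1+2r}`. -/
theorem hasSum_qWeight_mul_baileyKernel {q : ℂ} (hq : ‖q‖ < 1) (y : ℂ) (e r : ℕ) :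
    HasSum (fun n => qWeight q y (q ^ (e + 1)) n * baileyKernel q e n r)
      (qWeight q y (q ^ (e + 1)) r * qPochInf (y * q ^ r) q / qPochInf q q) := by
  rw [← hasSum_nat_add_iff' r, Finset.sum_eq_zero fun n hn => by
    rw [baileyKernel_of_lt q e (Finset.mem_range.1 hn), mul_zero], sub_zero]
  have h := (summable_qGaussTerm hq (y * q ^ r) (q ^ (e + 1) * q ^ (2 * r))).hasSum.mul_left
    (qWeight q y (q ^ (e + 1)) r / qPochInf q q)
  rw [tsum_qGaussTerm hq] at h
  refine h.congr_of_eq (fun m => ?_) ?_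
  · rw [baileyKernel_add, qWeight_add, mul_inv, inv_qPoch_self hq (m + 2 * r + e), qGaussTerm,
      ← pow_add, ← pow_add, show e + 1 + 2 * r + m = m + 2 * r + e + 1 by ring]
    ring
  · ring

/-- Row `n` of the double series has at most `n + 1` nonzero terms, each at most `M * C * ‖δ n‖`.
The factor `n + 1` in the hypothesis therefore gives absolute convergence and permits the
interchange. -/
theorem hasSum_mul_sum_of_bounded {δ α γ : ℕ → ℂ} {u : ℕ → ℕ → ℂ} {C M : ℝ}
    (hδ : Summable fun n : ℕ => ((n : ℝ) + 1) * ‖δ n‖) (hu : ∀ n r, ‖u n r‖ ≤ C)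
    (hα : ∀ r, ‖α r‖ ≤ M) (hu0 : ∀ n r, n < r → u n r = 0)
    (hγ : ∀ r, HasSum (fun n => δ n * u n r) (γ r)) :
    Summable (fun r => α r * γ r) ∧
      HasSum (fun n => δ n * ∑ r ∈ Finset.range (n + 1), α r * u n r) (∑' r, α r * γ r) := by
  have hC : 0 ≤ C := (norm_nonneg _).trans (hu 0 0)
  have hM : 0 ≤ M := (norm_nonneg _).trans (hα 0)
  let F : ℕ × ℕ → ℂ := fun p => α p.2 * (δ p.1 * u p.1 p.2)
  have hF0 : ∀ n, ∀ r ∉ Finset.range (n + 1), F (n, r) = 0 := fun n r hr => by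
    have : n < r := by simpa using hr
    simp [F, hu0 n r this]
  have hfib : ∀ n, HasSum (fun r => F (n, r)) (∑ r ∈ Finset.range (n + 1), F (n, r)) :=
    fun n => hasSum_sum_of_ne_finset_zero (hF0 n)
  have hfibn : ∀ n, HasSum (fun r => ‖F (n, r)‖) (∑ r ∈ Finset.range (n + 1), ‖F (n, r)‖) :=
    fun n => hasSum_sum_of_ne_finset_zero fun r hr => by rw [hF0 n r hr, norm_zero]
  have hF : Summable F := by
    refine Summable.of_norm ((summable_prod_of_nonneg fun _ => norm_nonneg _).2
      ⟨fun n => (hfibn n).summable, ?_⟩)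
    refine (hδ.mul_right (M * C)).of_nonneg_of_le (fun n => tsum_nonneg fun _ => norm_nonneg _)
      fun n => ?_
    rw [(hfibn n).tsum_eq]
    refine (Finset.sum_le_card_nsmul _ _ (M * (‖δ n‖ * C)) fun r _ => ?_).trans_eq ?_
    · simp only [F, norm_mul]
      gcongr
      · exact hα r
      · exact hu n r
    · rw [Finset.card_range, nsmul_eq_mul]
      push_cast
      ring
  have h1 := hF.hasSum.prod_fiberwise hfib
  have h2 : HasSum (fun r => α r * γ r) (∑' p, F p) :=
    ((Equiv.prodComm ℕ ℕ).hasSum_iff.2 hF.hasSum).prod_fiberwise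
      fun r => (hγ r).mul_left (α r)
  refine ⟨h2.summable, ?_⟩
  rw [h2.tsum_eq]
  refine h1.congr_of_eq (fun n => ?_) rfl
  rw [Finset.mul_sum]
  exact Finset.sum_congr rfl fun r _ => by simp only [F]; ring

/-- The limiting Bailey lemma relative to `q ^ e`. -/
theorem bailey_limit {q : ℂ} (hq : ‖q‖ < 1) (y : ℂ) (e : ℕ) {α : ℕ → ℂ} {M : ℝ}
    (hα : ∀ r, ‖α r‖ ≤ M) :
    Summable (fun r => α r * (qWeight q y (q ^ (e + 1)) r * qPochInf (y * q ^ r) q)) ∧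
    HasSum (fun n => qWeight q y (q ^ (e + 1)) n *
        ∑ r ∈ Finset.range (n + 1), α r * baileyKernel q e n r)
      ((∑' r, α r * (qWeight q y (q ^ (e + 1)) r * qPochInf (y * q ^ r) q)) / qPochInf q q) := by
  obtain ⟨C, -, hC⟩ := exists_norm_baileyKernel_le hq e
  obtain ⟨h1, h2⟩ := hasSum_mul_sum_of_bounded (summable_succ_mul_norm_qWeight hq y (q ^ (e + 1)))
    hC hα (fun n r h => baileyKernel_of_lt q e h)
    (hasSum_qWeight_mul_baileyKernel hq y e)
  have hP := qPochInf_ne_zero hq hq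
  simp only [← mul_div_assoc] at h1 h2
  rw [tsum_div_const] at h2
  exact ⟨by simpa [hP] using h1.mul_right (qPochInf q q), h2⟩

/-! ### A Bailey pair relative to `q ^ 2` in base `q ^ 2` -/

theorem baileyKernel_succ {q : ℂ} (hq : ‖q‖ < 1) (d r : ℕ) (e : ℕ) :
    baileyKernel q e (r + d) r = (1 - q ^ (d + 1)) * (1 - q ^ (d + 2 * r + e + 1)) *
      baileyKernel q e (r + d + 1) r := by
  rw [add_comm r d, baileyKernel_add, show d + r + 1 = d + 1 + r by ring, baileyKernel_add,
    show d + 1 + 2 * r + e = d + 2 * r + e + 1 by ring, qPoch_self_succ, qPoch_self_succ]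
  have h1 := qPoch_ne_zero hq hq d
  have h2 := qPoch_ne_zero hq hq (d + 2 * r + e)
  have h3 := one_sub_pow_ne_zero hq (d + 2 * r + e).succ_ne_zero
  have h4 := one_sub_pow_ne_zero hq d.succ_ne_zero
  field_simp

theorem baileyKernel_succ_right {q : ℂ} (hq : ‖q‖ < 1) (d r : ℕ) (e : ℕ) :
    (1 - q ^ (d + 2 * r + e + 2)) * baileyKernel q e (r + d + 1) (r + 1) = (1 - q ^ (d + 1)) *
      baileyKernel q e (r + d + 1) r := by
  rw [show r + d + 1 = d + (r + 1) by ring, baileyKernel_add,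
    show d + (r + 1) = d + 1 + r by ring, baileyKernel_add,
    show d + 1 + 2 * r + e = d + 2 * r + e + 1 by ring,
    show d + 2 * (r + 1) + e = d + 2 * r + e + 1 + 1 by ring, qPoch_self_succ q d,
    qPoch_self_succ q (d + 2 * r + e + 1)]
  have h1 := qPoch_ne_zero hq hq d
  have h2 := qPoch_ne_zero hq hq (d + 2 * r + e + 1)
  have h3 := one_sub_pow_ne_zero hq (d + 2 * r + e + 1).succ_ne_zero
  have h4 := one_sub_pow_ne_zero hq d.succ_ne_zero
  field_simp

/-- First-order recurrence in `n` for the sum, by creative telescoping. -/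
theorem sum_baileyKernel_step {q : ℂ} (hq : ‖q‖ < 1) (n : ℕ) :
    (1 - q ^ (2 * n + 3)) * (1 - q ^ (2 * n + 2)) ^ 2 * ∑ r ∈ Finset.range (n + 2),
        (-1) ^ r * q ^ r ^ 2 * (1 + q ^ (2 * r + 1)) * baileyKernel (q ^ 2) 1 (n + 1) r =
      (1 - q ^ (2 * n + 1)) * ∑ r ∈ Finset.range (n + 1),
        (-1) ^ r * q ^ r ^ 2 * (1 + q ^ (2 * r + 1)) * baileyKernel (q ^ 2) 1 n r := by
  have hQ : ‖q ^ 2‖ < 1 := norm_pow_lt_one hq two_ne_zero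
  -- The certificate vanishes at both ends: at `r = 0` through `1 - q^{2r}`, at `r = n + 2` through
  -- the kernel, where the truncated subtraction in the exponent is immaterial.
  let G : ℕ → ℂ := fun r => -(q ^ 2) ^ (n + 1 - r) * (1 - q ^ (2 * r)) ^ 2 *
    (1 - (q ^ 2) ^ (n + r + 2)) * ((-1) ^ r * q ^ r ^ 2) * baileyKernel (q ^ 2) 1 (n + 1) r
  have hG : ∀ r ∈ Finset.range (n + 2),
      (1 - q ^ (2 * n + 3)) * (1 - q ^ (2 * n + 2)) ^ 2 *
          ((-1) ^ r * q ^ r ^ 2 * (1 + q ^ (2 * r + 1)) * baileyKernel (q ^ 2) 1 (n + 1) r) -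
        (1 - q ^ (2 * n + 1)) *
          ((-1) ^ r * q ^ r ^ 2 * (1 + q ^ (2 * r + 1)) * baileyKernel (q ^ 2) 1 n r) =
        G (r + 1) - G r := by
    intro r hr
    have hr' : r ≤ n + 1 := by have := Finset.mem_range.1 hr; omega
    rcases hr'.eq_or_lt with rfl | hlt
    · simp only [G]
      rw [baileyKernel_of_lt _ _ n.lt_succ_self, baileyKernel_of_lt _ _ (n + 1).lt_succ_self,
        Nat.sub_self]
      ring
    · obtain ⟨d, rfl⟩ : ∃ d, n = r + d := ⟨n - r, by omega⟩
      have k1 := baileyKernel_succ hQ d r 1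
      have k2 := baileyKernel_succ_right hQ d r 1
      simp only [G]
      rw [show r + d + 1 - r = d + 1 by omega, show r + d + 1 - (r + 1) = d by omega, k1,
        show (r + d + (r + 1) + 2) = d + 2 * r + 1 + 2 by ring]
      -- The last factor of `G (r + 1)` is what `baileyKernel_succ_right` needs to express the
      -- kernel at `r + 1` through the one at `r`.
      have k3 : ∀ A B : ℂ, A * (1 - (q ^ 2) ^ (d + 2 * r + 1 + 2)) * B *
          baileyKernel (q ^ 2) 1 (r + d + 1) (r + 1) = A * B * ((1 - (q ^ 2) ^ (d + 1)) *
          baileyKernel (q ^ 2) 1 (r + d + 1) r) := fun A B => by rw [← k2]; ring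
      rw [k3]
      ring
  have h1 := Finset.sum_congr rfl hG
  rw [Finset.sum_range_sub, Finset.sum_sub_distrib, ← Finset.mul_sum, ← Finset.mul_sum] at h1
  have h2 : G (n + 2) = 0 := by
    simp only [G]; rw [baileyKernel_of_lt _ _ (n + 1).lt_succ_self, mul_zero]
  have h3 : G 0 = 0 := by simp [G]
  rw [h2, h3, sub_zero, sub_eq_zero] at h1
  rw [h1, Finset.sum_range_succ _ (n + 1), baileyKernel_of_lt _ _ n.lt_succ_self]
  ring

theorem sum_baileyKernel {q : ℂ} (hq : ‖q‖ < 1) (n : ℕ) :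
    ∑ r ∈ Finset.range (n + 1),
        (-1) ^ r * q ^ r ^ 2 * (1 + q ^ (2 * r + 1)) * baileyKernel (q ^ 2) 1 n r =
      ((1 - q ^ (2 * n + 1)) *
        (qPoch (q ^ 2) (q ^ 2) n * qPoch (q ^ 2) (q ^ 2) n))⁻¹ := by
  have hQ : ‖q ^ 2‖ < 1 := norm_pow_lt_one hq two_ne_zero
  induction n with
  | zero =>
    have h1 := one_sub_pow_ne_zero hq two_ne_zero
    have h2 := one_sub_ne_zero_of_norm_lt hq
    simp [baileyKernel, qPoch]
    field_simp
    ring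
  | succ n ih =>
    have h := sum_baileyKernel_step hq n
    rw [ih] at h
    have h1 := one_sub_pow_ne_zero hq (2 * n).succ_ne_zero
    have h2 := one_sub_pow_ne_zero hq (2 * n + 2).succ_ne_zero
    have h3 := one_sub_pow_ne_zero hq (2 * n + 1).succ_ne_zero
    have h4 := qPoch_ne_zero hQ hQ n
    rw [qPoch_self_succ, ← pow_mul, show 2 * (n + 1) + 1 = 2 * n + 3 by ring,
      show 2 * (n + 1) = 2 * n + 2 by ring]
    rw [show n + 1 + 1 = n + 2 by ring, ← mul_right_inj' (mul_ne_zero h2 (pow_ne_zero 2 h3)), h]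
    field_simp

/-! ### Elementary summation lemmas -/

theorem norm_pow_le_one {q : ℂ} (hq : ‖q‖ < 1) (n : ℕ) : ‖q ^ n‖ ≤ 1 := by
  rw [norm_pow]
  exact pow_le_one₀ (norm_nonneg q) hq.le

theorem summable_pow_of_le {q : ℂ} (hq : ‖q‖ < 1) {f : ℕ → ℕ} (hf : ∀ n, n ≤ f n) :
    Summable fun n => q ^ f n := by
  refine Summable.of_norm_bounded (summable_geometric_of_lt_one (norm_nonneg q) hq) fun n => ?_
  rw [norm_pow]
  exact pow_le_pow_of_le_one (norm_nonneg q) hq.le (hf n)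

theorem Summable.pairs {f : ℕ → ℂ} (hf : Summable f) :
    HasSum (fun k => f (2 * k) + f (2 * k + 1)) (∑' n, f n) := by
  have h1 : Summable fun k => f (2 * k) := hf.comp_injective (i := fun k => 2 * k) fun a b h => by
    simpa using h
  have h2 : Summable fun k => f (2 * k + 1) :=
    hf.comp_injective (i := fun k => 2 * k + 1) fun a b h => by simpa using h
  rw [← tsum_even_add_odd h1 h2]
  exact h1.hasSum.add h2.hasSum

theorem neg_one_pow_sq (r : ℕ) : (-1 : ℂ) ^ r ^ 2 = (-1) ^ r := by
  rcases Nat.even_or_odd r with h | h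
  · rw [h.neg_one_pow, (h.pow_of_ne_zero two_ne_zero).neg_one_pow]
  · rw [h.neg_one_pow, h.pow.neg_one_pow]

/-! ### Specialised weights -/

theorem qWeight_zero_left (q : ℂ) (n : ℕ) : qWeight q 0 (q ^ 2) n = q ^ (n ^ 2 + n) := by
  induction n with
  | zero => simp [qWeight_zero]
  | succ n ih => rw [qWeight_succ, ih]; ring

theorem choose_two_add_self (n : ℕ) : n.choose 2 + n = (n ^ 2 + n) / 2 := by
  have := two_mul_choose_two_add n
  omega

theorem qWeight_neg_self (q : ℂ) (n : ℕ) :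
    qWeight q (-q) (q ^ 2) n = qPoch (-q) q n * q ^ ((n ^ 2 + n) / 2) := by
  rw [← choose_two_add_self]
  induction n with
  | zero => simp [qWeight_zero, qPoch_zero]
  | succ n ih => rw [qWeight_succ, ih, qPoch_succ, choose_two_succ]; ring

theorem qWeight_sq (q : ℂ) (e n : ℕ) :
    qWeight (q ^ 2) (-q) ((q ^ 2) ^ (e + 1)) n * qPoch (-q) (q ^ 2) e =
      qPoch (-q) (q ^ 2) (n + e) * q ^ n ^ 2 := by
  induction n with
  | zero => simp [qWeight_zero]
  | succ n ih =>
    rw [qWeight_succ, mul_assoc, ih, show n + 1 + e = n + e + 1 by ring, qPoch_succ]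
    ring

theorem qWeight_neg_self_mul {q : ℂ} (hq : ‖q‖ < 1) (r : ℕ) :
    qWeight q (-q) (q ^ 2) r * qPochInf (-q * q ^ r) q =
      qPochInf (-q) q * q ^ ((r ^ 2 + r) / 2) := by
  rw [qWeight_neg_self, qPochInf_eq_qPoch_mul (-q) hq r]
  ring

/-! ### Bailey pairs relative to `q` -/

theorem sum_neg_baileyKernel {p : ℂ} (hp : ‖p‖ < 1) (n : ℕ) :
    ∑ r ∈ Finset.range (n + 1), p ^ r ^ 2 * (1 - p ^ (2 * r + 1)) * baileyKernel (p ^ 2) 1 n r =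
      ((1 + p ^ (2 * n + 1)) *
        (qPoch (p ^ 2) (p ^ 2) n * qPoch (p ^ 2) (p ^ 2) n))⁻¹ := by
  have h := sum_baileyKernel (q := -p) (by rwa [norm_neg]) n
  rw [neg_sq, (odd_two_mul_add_one n).neg_pow, sub_neg_eq_add] at h
  rw [← h]
  refine Finset.sum_congr rfl fun r _ => ?_
  rw [(odd_two_mul_add_one r).neg_pow, neg_pow p, neg_one_pow_sq, ← mul_assoc, ← mul_pow]
  simp [sub_eq_add_neg]

/-- The coefficients `α_{2k} = q^{2k²}`, `α_{2k+1} = -q^{2(k+1)²}`. -/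
noncomputable def evenAlpha (q : ℂ) (r : ℕ) : ℂ := (-1) ^ r * q ^ (2 * ((r + 1) / 2) ^ 2)

/-- The coefficients `α_{2k} = q^{2k²+2k}`, `α_{2k+1} = -q^{2k²+2k}`. -/
noncomputable def oddAlpha (q : ℂ) (r : ℕ) : ℂ := (-1) ^ r * q ^ (2 * (r / 2) ^ 2 + 2 * (r / 2))

theorem norm_evenAlpha_le {q : ℂ} (hq : ‖q‖ < 1) (r : ℕ) : ‖evenAlpha q r‖ ≤ 1 := by
  simpa [evenAlpha] using norm_pow_le_one hq _

theorem norm_oddAlpha_le {q : ℂ} (hq : ‖q‖ < 1) (r : ℕ) : ‖oddAlpha q r‖ ≤ 1 := by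
  simpa [oddAlpha] using norm_pow_le_one hq _

theorem evenAlpha_even (q : ℂ) (k : ℕ) : evenAlpha q (2 * k) = q ^ (2 * k ^ 2) := by
  rw [evenAlpha, show (2 * k + 1) / 2 = k by omega]; simp

theorem evenAlpha_odd (q : ℂ) (k : ℕ) : evenAlpha q (2 * k + 1) = -q ^ (2 * (k + 1) ^ 2) := by
  rw [evenAlpha, show (2 * k + 1 + 1) / 2 = k + 1 by omega]; simp [pow_succ (-1 : ℂ)]

theorem oddAlpha_even (q : ℂ) (k : ℕ) : oddAlpha q (2 * k) = q ^ (2 * k ^ 2 + 2 * k) := by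
  rw [oddAlpha, show 2 * k / 2 = k by omega]; simp

theorem oddAlpha_odd (q : ℂ) (k : ℕ) : oddAlpha q (2 * k + 1) = -q ^ (2 * k ^ 2 + 2 * k) := by
  rw [oddAlpha, show (2 * k + 1) / 2 = k by omega]; simp [pow_succ (-1 : ℂ)]

/-- In the half sum of the pairs for `p` and `-p`, the parity of `r` decides which of the two
monomials of `p^{r²}(1 ± p^{2r+1})` survives. The remaining exponent is even, so the result depends
on `p²` only. -/
theorem two_mul_evenAlpha_sq (p : ℂ) (r : ℕ) :
    2 * evenAlpha (p ^ 2) r =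
      (-1) ^ r * p ^ r ^ 2 * (1 + p ^ (2 * r + 1)) + p ^ r ^ 2 * (1 - p ^ (2 * r + 1)) := by
  obtain ⟨k, rfl | rfl⟩ := Nat.even_or_odd' r
  · rw [evenAlpha_even, (even_two_mul k).neg_one_pow]; ring
  · rw [evenAlpha_odd, (odd_two_mul_add_one k).neg_one_pow]; ring

theorem two_mul_oddAlpha_sq (p : ℂ) (r : ℕ) :
    2 * p * oddAlpha (p ^ 2) r =
      (-1) ^ r * p ^ r ^ 2 * (1 + p ^ (2 * r + 1)) - p ^ r ^ 2 * (1 - p ^ (2 * r + 1)) := by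
  obtain ⟨k, rfl | rfl⟩ := Nat.even_or_odd' r
  · rw [oddAlpha_even, (even_two_mul k).neg_one_pow]; ring
  · rw [oddAlpha_odd, (odd_two_mul_add_one k).neg_one_pow]; ring

theorem exists_sq_eq_of_norm_lt_one {q : ℂ} (hq : ‖q‖ < 1) : ∃ p : ℂ, ‖p‖ < 1 ∧ p ^ 2 = q := by
  obtain ⟨p, hp⟩ := IsAlgClosed.exists_pow_nat_eq q two_pos
  refine ⟨p, ?_, hp⟩
  rw [← hp, norm_pow] at hq
  exact (sq_lt_one_iff₀ (norm_nonneg p)).1 hq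

theorem sum_evenAlpha_mul_baileyKernel {q : ℂ} (hq : ‖q‖ < 1) (n : ℕ) :
    ∑ r ∈ Finset.range (n + 1), evenAlpha q r * baileyKernel q 1 n r =
      ((1 - q ^ (2 * n + 1)) * (qPoch q q n * qPoch q q n))⁻¹ := by
  obtain ⟨p, hp, rfl⟩ := exists_sq_eq_of_norm_lt_one hq
  have h1 := sum_baileyKernel hp n
  have h2 := sum_neg_baileyKernel hp n
  have h3 : 2 * ∑ r ∈ Finset.range (n + 1), evenAlpha (p ^ 2) r * baileyKernel (p ^ 2) 1 n r =
      ((1 - p ^ (2 * n + 1)) * (qPoch (p ^ 2) (p ^ 2) n * qPoch (p ^ 2) (p ^ 2) n))⁻¹ +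
      ((1 + p ^ (2 * n + 1)) * (qPoch (p ^ 2) (p ^ 2) n * qPoch (p ^ 2) (p ^ 2) n))⁻¹ := by
    rw [← h1, ← h2, ← Finset.sum_add_distrib, Finset.mul_sum]
    refine Finset.sum_congr rfl fun r _ => ?_
    rw [← mul_assoc, two_mul_evenAlpha_sq]; ring
  have h4 := one_sub_pow_ne_zero hp (2 * n).succ_ne_zero
  have h5 := one_sub_pow_ne_zero (q := -p) (by rwa [norm_neg]) (2 * n).succ_ne_zero
  rw [Nat.succ_eq_add_one, (odd_two_mul_add_one n).neg_pow, sub_neg_eq_add] at h5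
  have h6 := qPoch_ne_zero hq hq n
  rw [← mul_right_inj' (two_ne_zero (α := ℂ)), h3, ← pow_mul, mul_comm 2 (2 * n + 1), pow_mul,
    show 1 - (p ^ (2 * n + 1)) ^ 2 = (1 - p ^ (2 * n + 1)) * (1 + p ^ (2 * n + 1)) by ring]
  rw [Nat.succ_eq_add_one] at h4
  generalize p ^ (2 * n + 1) = x at *
  field_simp
  ring

theorem sum_oddAlpha_mul_baileyKernel {q : ℂ} (hq : ‖q‖ < 1) (n : ℕ) :
    ∑ r ∈ Finset.range (n + 1), oddAlpha q r * baileyKernel q 1 n r =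
      q ^ n * ((1 - q ^ (2 * n + 1)) * (qPoch q q n * qPoch q q n))⁻¹ := by
  -- The half difference has to be divided by `p`, so `q = 0` is treated apart: there the terms `r =
  -- 0, 1` cancel and all later coefficients vanish.
  obtain rfl | hq0 := eq_or_ne q 0
  · have hP : ∀ n, qPoch 0 0 n = 1 := fun n => by simp [qPoch]
    rcases n with - | n
    · simp [oddAlpha, baileyKernel, hP]
    · rw [Finset.sum_range_succ', Finset.sum_range_succ', Finset.sum_eq_zero fun k _ => ?_]
      · simp [oddAlpha, baileyKernel, hP]
      · have : (k + 1 + 1) / 2 ≠ 0 := by omega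
        simp [oddAlpha, this]
  obtain ⟨p, hp, rfl⟩ := exists_sq_eq_of_norm_lt_one hq
  have hp0 : p ≠ 0 := by rintro rfl; simp at hq0
  have h1 := sum_baileyKernel hp n
  have h2 := sum_neg_baileyKernel hp n
  have h3 : 2 * p * ∑ r ∈ Finset.range (n + 1), oddAlpha (p ^ 2) r * baileyKernel (p ^ 2) 1 n r =
      ((1 - p ^ (2 * n + 1)) * (qPoch (p ^ 2) (p ^ 2) n * qPoch (p ^ 2) (p ^ 2) n))⁻¹ -
      ((1 + p ^ (2 * n + 1)) * (qPoch (p ^ 2) (p ^ 2) n * qPoch (p ^ 2) (p ^ 2) n))⁻¹ := by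
    rw [← h1, ← h2, ← Finset.sum_sub_distrib, Finset.mul_sum]
    refine Finset.sum_congr rfl fun r _ => ?_
    rw [← mul_assoc, two_mul_oddAlpha_sq]; ring
  have h4 := one_sub_pow_ne_zero hp (2 * n).succ_ne_zero
  have h5 := one_sub_pow_ne_zero (q := -p) (by rwa [norm_neg]) (2 * n).succ_ne_zero
  rw [Nat.succ_eq_add_one, (odd_two_mul_add_one n).neg_pow, sub_neg_eq_add] at h5
  have h6 := qPoch_ne_zero hq hq n
  rw [← mul_right_inj' (mul_ne_zero two_ne_zero hp0), h3, ← pow_mul p 2 (2 * n + 1),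
    mul_comm 2 (2 * n + 1), pow_mul p (2 * n + 1),
    show 1 - (p ^ (2 * n + 1)) ^ 2 = (1 - p ^ (2 * n + 1)) * (1 + p ^ (2 * n + 1)) by ring,
    ← pow_mul, mul_assoc 2 p, ← mul_assoc p, ← pow_succ']
  rw [Nat.succ_eq_add_one] at h4
  generalize p ^ (2 * n + 1) = x at *
  field_simp
  ring

/-! ### The identities in base `q` -/

theorem hasSum_pow_sq_add_self_div {q : ℂ} (hq : ‖q‖ < 1) :
    Summable (fun r : ℕ => q ^ (6 * r ^ 2 + 2 * r) * (1 - q ^ (8 * r + 4))) ∧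
      HasSum (fun n : ℕ => q ^ (n ^ 2 + n) /
          ((1 - q ^ (2 * n + 1)) * (qPoch q q n * qPoch q q n)))
        ((∑' r : ℕ, q ^ (6 * r ^ 2 + 2 * r) * (1 - q ^ (8 * r + 4))) / qPochInf q q) := by
  obtain ⟨h1, h2⟩ := bailey_limit hq 0 1 (norm_evenAlpha_le hq)
  simp only [sum_evenAlpha_mul_baileyKernel hq, Nat.reduceAdd, qWeight_zero_left, zero_mul,
    qPochInf_zero, mul_one] at h1 h2
  have h3 := h1.pairs.congr_of_eq
    (g := fun r : ℕ => q ^ (6 * r ^ 2 + 2 * r) * (1 - q ^ (8 * r + 4)))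
    (fun k => by rw [evenAlpha_even, evenAlpha_odd]; ring) rfl
  exact ⟨h3.summable, h2.congr_of_eq (fun n => div_eq_mul_inv _ _) (by rw [h3.tsum_eq])⟩

theorem hasSum_pow_sq_add_two_mul_div {q : ℂ} (hq : ‖q‖ < 1) :
    Summable (fun r : ℕ => q ^ (6 * r ^ 2 + 4 * r) * (1 - q ^ (4 * r + 2))) ∧
      HasSum (fun n : ℕ => q ^ (n ^ 2 + 2 * n) /
          ((1 - q ^ (2 * n + 1)) * (qPoch q q n * qPoch q q n)))
        ((∑' r : ℕ, q ^ (6 * r ^ 2 + 4 * r) * (1 - q ^ (4 * r + 2))) / qPochInf q q) := by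
  obtain ⟨h1, h2⟩ := bailey_limit hq 0 1 (norm_oddAlpha_le hq)
  simp only [sum_oddAlpha_mul_baileyKernel hq, Nat.reduceAdd, qWeight_zero_left, zero_mul,
    qPochInf_zero, mul_one] at h1 h2
  have h3 := h1.pairs.congr_of_eq
    (g := fun r : ℕ => q ^ (6 * r ^ 2 + 4 * r) * (1 - q ^ (4 * r + 2)))
    (fun k => by rw [oddAlpha_even, oddAlpha_odd]; ring) rfl
  exact ⟨h3.summable, h2.congr_of_eq
    (fun n => by rw [div_eq_mul_inv]; ring) (by rw [h3.tsum_eq])⟩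

theorem half_even (k : ℕ) : ((2 * k) ^ 2 + 2 * k) / 2 = 2 * k ^ 2 + k := by
  rw [show (2 * k) ^ 2 + 2 * k = 2 * (2 * k ^ 2 + k) by ring]
  omega

theorem half_odd (k : ℕ) : ((2 * k + 1) ^ 2 + (2 * k + 1)) / 2 = 2 * k ^ 2 + 3 * k + 1 := by
  rw [show (2 * k + 1) ^ 2 + (2 * k + 1) = 2 * (2 * k ^ 2 + 3 * k + 1) by ring]
  omega

theorem half_add_self (n : ℕ) : (n ^ 2 + 3 * n) / 2 = (n ^ 2 + n) / 2 + n := by omega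

theorem summable_of_mul_qPochInf {q : ℂ} (hq : ‖q‖ < 1) {a : ℂ} (ha : ‖a‖ < 1) {α f : ℕ → ℂ}
    (h : Summable fun r => α r * (qPochInf a q * f r)) : Summable fun r => α r * f r := by
  have h0 := qPochInf_ne_zero ha hq
  refine (h.mul_left (qPochInf a q)⁻¹).congr fun r => ?_
  field_simp

theorem tsum_mul_qPochInf (q a : ℂ) (α f : ℕ → ℂ) :
    ∑' r, α r * (qPochInf a q * f r) = qPochInf a q * ∑' r, α r * f r := by
  rw [← tsum_mul_left]
  exact tsum_congr fun r => by ring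

theorem hasSum_qPoch_neg_mul_pow_half_div {q : ℂ} (hq : ‖q‖ < 1) :
    Summable (fun r : ℕ => q ^ (4 * r ^ 2 + r) * (1 - q ^ (6 * r + 3))) ∧
      HasSum (fun n : ℕ => qPoch (-q) q n * q ^ ((n ^ 2 + n) / 2) /
          ((1 - q ^ (2 * n + 1)) * (qPoch q q n * qPoch q q n)))
        (qPochInf (-q) q / qPochInf q q *
          ∑' r : ℕ, q ^ (4 * r ^ 2 + r) * (1 - q ^ (6 * r + 3))) := by
  obtain ⟨h1, h2⟩ := bailey_limit hq (-q) 1 (norm_evenAlpha_le hq)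
  simp only [sum_evenAlpha_mul_baileyKernel hq, Nat.reduceAdd, qWeight_neg_self_mul hq,
    tsum_mul_qPochInf] at h1 h2
  replace h1 := summable_of_mul_qPochInf hq (by rwa [norm_neg]) h1
  have h3 := h1.pairs.congr_of_eq
    (g := fun r : ℕ => q ^ (4 * r ^ 2 + r) * (1 - q ^ (6 * r + 3)))
    (fun k => by rw [evenAlpha_even, evenAlpha_odd, half_even, half_odd]; ring) rfl
  exact ⟨h3.summable, h2.congr_of_eq (fun n => by rw [div_eq_mul_inv, qWeight_neg_self])
    (by rw [h3.tsum_eq]; ring)⟩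

theorem hasSum_qPoch_neg_mul_pow_half_add_div {q : ℂ} (hq : ‖q‖ < 1) :
    Summable (fun r : ℕ => q ^ (4 * r ^ 2 + 3 * r) * (1 - q ^ (2 * r + 1))) ∧
      HasSum (fun n : ℕ => qPoch (-q) q n * q ^ ((n ^ 2 + 3 * n) / 2) /
          ((1 - q ^ (2 * n + 1)) * (qPoch q q n * qPoch q q n)))
        (qPochInf (-q) q / qPochInf q q *
          ∑' r : ℕ, q ^ (4 * r ^ 2 + 3 * r) * (1 - q ^ (2 * r + 1))) := by
  obtain ⟨h1, h2⟩ := bailey_limit hq (-q) 1 (norm_oddAlpha_le hq)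
  simp only [sum_oddAlpha_mul_baileyKernel hq, Nat.reduceAdd, qWeight_neg_self_mul hq,
    tsum_mul_qPochInf] at h1 h2
  replace h1 := summable_of_mul_qPochInf hq (by rwa [norm_neg]) h1
  have h3 := h1.pairs.congr_of_eq
    (g := fun r : ℕ => q ^ (4 * r ^ 2 + 3 * r) * (1 - q ^ (2 * r + 1)))
    (fun k => by rw [oddAlpha_even, oddAlpha_odd, half_even, half_odd]; ring) rfl
  exact ⟨h3.summable, h2.congr_of_eq
    (fun n => by rw [div_eq_mul_inv, qWeight_neg_self, half_add_self, pow_add]; ring)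
    (by rw [h3.tsum_eq]; ring)⟩

/-! ### The identities in base `q ^ 2` -/

/-- Expresses the kernel for `e = 1` through two kernels for `e = 0`, so that weights relative to `e
= 0` can be summed against it. -/
theorem baileyKernel_zero_sub {q : ℂ} (hq : ‖q‖ < 1) (n r : ℕ) :
    (1 - q ^ (2 * r + 1)) * baileyKernel q 1 n r =
      baileyKernel q 0 n r - q ^ (2 * r + 1) * baileyKernel q 0 n (r + 1) := by
  rcases lt_trichotomy n r with h | rfl | h
  · rw [baileyKernel_of_lt _ _ h, baileyKernel_of_lt _ _ h,
      baileyKernel_of_lt _ _ (h.trans r.lt_succ_self)]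
    ring
  · rw [baileyKernel_of_lt _ _ n.lt_succ_self]
    have h1 := baileyKernel_add q 0 0 n
    have h2 := baileyKernel_add q 1 0 n
    simp only [zero_add, add_zero, qPoch_zero, one_mul] at h1 h2
    rw [h1, h2, qPoch_self_succ]
    have h3 := qPoch_ne_zero hq hq (2 * n)
    have h4 := one_sub_pow_ne_zero hq (2 * n).succ_ne_zero
    field_simp
    ring
  · obtain ⟨d, rfl⟩ : ∃ d, n = d + (r + 1) := ⟨n - (r + 1), by omega⟩
    rw [baileyKernel_add, show d + (r + 1) = d + 1 + r by ring, baileyKernel_add,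
      baileyKernel_add, show d + 1 + 2 * r + 1 = d + 2 * r + 1 + 1 by ring,
      show d + 1 + 2 * r + 0 = d + 2 * r + 1 by ring,
      show d + 2 * (r + 1) + 0 = d + 2 * r + 1 + 1 by ring,
      qPoch_self_succ q (d + 2 * r + 1), qPoch_self_succ q d]
    have h1 := qPoch_ne_zero hq hq d
    have h2 := qPoch_ne_zero hq hq (d + 2 * r + 1)
    have h3 := one_sub_pow_ne_zero hq d.succ_ne_zero
    have h4 := one_sub_pow_ne_zero hq (d + 2 * r + 1).succ_ne_zero
    field_simp
    ring

theorem qWeight_sq_zero (q : ℂ) (n : ℕ) :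
    qWeight (q ^ 2) (-q) (q ^ 2) n = qPoch (-q) (q ^ 2) n * q ^ n ^ 2 := by
  simpa [qPoch_zero] using qWeight_sq q 0 n

theorem qWeight_sq_mul {q : ℂ} (hq : ‖q‖ < 1) (r : ℕ) :
    qWeight (q ^ 2) (-q) (q ^ 2) r * qPochInf (-q * (q ^ 2) ^ r) (q ^ 2) =
      qPochInf (-q) (q ^ 2) * q ^ r ^ 2 := by
  rw [qWeight_sq_zero, qPochInf_eq_qPoch_mul (-q) (norm_pow_lt_one hq two_ne_zero) r]
  ring

theorem hasSum_qPoch_neg_sq_div {q : ℂ} (hq : ‖q‖ < 1) :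
    Summable (fun r : ℕ => q ^ (8 * r ^ 2 + 4 * r + 1) * (1 - q ^ (8 * r + 4))) ∧
      HasSum
        (fun n : ℕ => qPoch (-q) (q ^ 2) n * q ^ (n ^ 2) /
          ((1 - q ^ (2 * n + 1)) * (qPoch (q ^ 2) (q ^ 2) n * qPoch (q ^ 2) (q ^ 2) n)))
        (qPochInf (-q) (q ^ 2) / qPochInf (q ^ 2) (q ^ 2) *
          (1 + ∑' r : ℕ, q ^ (8 * r ^ 2 + 4 * r + 1) * (1 - q ^ (8 * r + 4)))) := by
  have hQ : ‖q ^ 2‖ < 1 := norm_pow_lt_one hq two_ne_zero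
  have hγ : ∀ r, HasSum
      (fun n => qWeight (q ^ 2) (-q) (q ^ 2) n * baileyKernel (q ^ 2) 1 n r)
      (qPochInf (-q) (q ^ 2) / qPochInf (q ^ 2) (q ^ 2) *
        ((q ^ r ^ 2 - (q ^ 2) ^ (2 * r + 1) * q ^ (r + 1) ^ 2) / (1 - (q ^ 2) ^ (2 * r + 1)))) := by
    intro r
    have h0 := hasSum_qWeight_mul_baileyKernel hQ (-q) 0 r
    have h1 := hasSum_qWeight_mul_baileyKernel hQ (-q) 0 (r + 1)
    simp only [zero_add, pow_one, qWeight_sq_mul hq] at h0 h1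
    have h2 := one_sub_pow_ne_zero hQ (2 * r).succ_ne_zero
    refine ((h0.sub (h1.mul_left ((q ^ 2) ^ (2 * r + 1)))).mul_left
      (1 - (q ^ 2) ^ (2 * r + 1))⁻¹).congr_of_eq (fun n => ?_) (by ring)
    rw [eq_inv_mul_iff_mul_eq₀ h2, mul_left_comm, baileyKernel_zero_sub hQ]
    ring
  obtain ⟨C, -, hC⟩ := exists_norm_baileyKernel_le hQ 1
  obtain ⟨h1, h2⟩ := hasSum_mul_sum_of_bounded (M := 2)
    (α := fun r => (-1) ^ r * q ^ r ^ 2 * (1 + q ^ (2 * r + 1)))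
    (summable_succ_mul_norm_qWeight hQ (-q) (q ^ 2)) hC
    (fun r => by
      rw [norm_mul, norm_mul, norm_pow, norm_neg, norm_one, one_pow, one_mul]
      have h3 := norm_add_le 1 (q ^ (2 * r + 1))
      rw [norm_one] at h3
      nlinarith [norm_pow_le_one hq (r ^ 2), norm_pow_le_one hq (2 * r + 1),
        norm_nonneg (q ^ r ^ 2), norm_nonneg (1 + q ^ (2 * r + 1))])
    (fun n r h => baileyKernel_of_lt (q ^ 2) 1 h) hγ
  -- With `x = q^{2r+1}` the term `α_r γ_r` is, up to the product in front, `(-1)^r q^{2r²}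
  -- (1+x)(1-x³)/(1-x²) = (-1)^r q^{2r²} (1+x+x²)`. The part `1 + x²` is `f r - f (r + 1)` and
  -- telescopes to `1`; the part `x` is `g r`.
  let f : ℕ → ℂ := fun r => (-1) ^ r * q ^ (2 * r ^ 2)
  let g : ℕ → ℂ := fun r => (-1) ^ r * q ^ (2 * r ^ 2 + 2 * r + 1)
  have hf : Summable f := by
    refine Summable.of_norm ?_
    simpa [f] using (summable_pow_of_le hq (f := fun r => 2 * r ^ 2) fun n => by nlinarith).norm
  have hg : Summable g := by
    refine Summable.of_norm ?_
    simpa [g] using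
      (summable_pow_of_le hq (f := fun r => 2 * r ^ 2 + 2 * r + 1) fun n => by nlinarith).norm
  have h3 := hg.pairs.congr_of_eq
    (g := fun r : ℕ => q ^ (8 * r ^ 2 + 4 * r + 1) * (1 - q ^ (8 * r + 4)))
    (fun k => by
      simp only [g]
      rw [(even_two_mul k).neg_one_pow, (odd_two_mul_add_one k).neg_one_pow]
      ring) rfl
  have h4 : HasSum (fun r => f r - f (r + 1)) 1 := by
    have := hf.hasSum.sub ((summable_nat_add_iff 1).2 hf).hasSum
    refine this.congr_of_eq (fun _ => rfl) ?_
    rw [hf.tsum_eq_zero_add]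
    simp [f]
  refine ⟨h3.summable, h2.congr_of_eq (fun n => ?_) ?_⟩
  · rw [sum_baileyKernel hq, qWeight_sq_zero, div_eq_mul_inv]
  · rw [h3.tsum_eq, eq_comm]
    refine (((h4.add hg.hasSum).mul_left
      (qPochInf (-q) (q ^ 2) / qPochInf (q ^ 2) (q ^ 2))).congr_of_eq (fun r => ?_) rfl).tsum_eq
    have h5 : 1 - (q ^ 2) ^ (2 * r + 1) ≠ 0 := one_sub_pow_ne_zero hQ (2 * r).succ_ne_zero
    rw [mul_left_comm]
    congr 1
    simp only [f, g]
    rw [← mul_div_assoc, div_eq_iff h5]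
    ring

theorem hasSum_qPoch_neg_sq_succ_div {q : ℂ} (hq : ‖q‖ < 1) (hq0 : q ≠ 0) :
    Summable (fun r : ℕ => q ^ (r ^ 2) * (q ^ (-(2 * r : ℤ)) - q ^ (2 * r))) ∧
      HasSum
        (fun n : ℕ => qPoch (-q) (q ^ 2) (n + 1) * q ^ ((n : ℤ) ^ 2 - 2 * n) /
          (qPoch (q ^ 2) (q ^ 2) n * qPoch (q ^ 2) (q ^ 2) (n + 1)))
        (qPochInf (-q) (q ^ 2) / qPochInf (q ^ 2) (q ^ 2) *
          (1 + q + q ^ 2 + q ^ 3 +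
            ∑' r : ℕ, q ^ (r ^ 2) * (q ^ (-(2 * r : ℤ)) - q ^ (2 * r)))) := by
  have hQ : ‖q ^ 2‖ < 1 := norm_pow_lt_one hq two_ne_zero
  -- The summand is `q⁻¹ (q^{(r-1)²} - q^{(r+1)²})`, which telescopes with step two and leaves the
  -- terms at `r = 0, 1`.
  have hg : HasSum (fun r : ℕ => q ^ (r ^ 2) * (q ^ (-(2 * r : ℤ)) - q ^ (2 * r))) (1 + q⁻¹) := by
    let h : ℕ → ℂ := fun r => q ^ (((r : ℤ) - 1) ^ 2)
    have hh : Summable h := by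
      rw [← summable_nat_add_iff 1]
      refine (summable_pow_of_le hq (f := fun r => r ^ 2) fun n => by nlinarith).congr fun n => ?_
      simp only [h]
      rw [← zpow_natCast]
      congr 1
      push_cast
      ring
    have h1 := (hh.hasSum.sub ((summable_nat_add_iff 2).2 hh).hasSum).mul_left q⁻¹
    refine h1.congr_of_eq (fun r => ?_) ?_
    · simp only [h]
      rw [mul_sub, mul_sub, ← zpow_natCast q (r ^ 2), ← zpow_natCast q (2 * r), ← zpow_neg_one,
        ← zpow_add₀ hq0, ← zpow_add₀ hq0, ← zpow_add₀ hq0, ← zpow_add₀ hq0]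
      push_cast
      ring_nf
    · rw [← hh.sum_add_tsum_nat_add 2, Finset.sum_range_succ, Finset.sum_range_one]
      simp [h]
      field_simp
  -- The left side is split by `q^{n²-2n} = q^{n²} + q^{n²-2n}(1-q^{2n})`. The first part is the
  -- case `e = 1`, `r = 0` of the `q`-Gauss sum.
  have h1 : HasSum (fun n : ℕ => qPoch (-q) (q ^ 2) (n + 1) * q ^ n ^ 2 /
      (qPoch (q ^ 2) (q ^ 2) n * qPoch (q ^ 2) (q ^ 2) (n + 1)))
      ((1 + q) * (qPochInf (-q) (q ^ 2) / qPochInf (q ^ 2) (q ^ 2))) := by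
    refine ((hasSum_qWeight_mul_baileyKernel hQ (-q) 1 0).mul_left
      (qPoch (-q) (q ^ 2) 1)).congr_of_eq (fun n => ?_) ?_
    · have := baileyKernel_add (q ^ 2) 1 n 0
      simp only [mul_zero, add_zero] at this
      rw [this, ← qWeight_sq]
      ring
    · simp [qPoch, qWeight_zero]
  have h2 : HasSum (fun n : ℕ => qPoch (-q) (q ^ 2) (n + 2) * q ^ n ^ 2 /
      (qPoch (q ^ 2) (q ^ 2) n * qPoch (q ^ 2) (q ^ 2) (n + 2)))
      ((1 + q) * (1 + q ^ 3) * (qPochInf (-q) (q ^ 2) / qPochInf (q ^ 2) (q ^ 2))) := by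
    refine ((hasSum_qWeight_mul_baileyKernel hQ (-q) 2 0).mul_left
      (qPoch (-q) (q ^ 2) 2)).congr_of_eq (fun n => ?_) ?_
    · have := baileyKernel_add (q ^ 2) 2 n 0
      simp only [mul_zero, add_zero] at this
      rw [this, ← qWeight_sq]
      ring
    · simp only [qPoch, qWeight_zero, Finset.prod_range_succ, Finset.prod_range_zero, pow_zero,
        mul_one, one_mul, pow_one]
      ring
  -- The second part vanishes at `n = 0`. After the shift `n ↦ n + 1` the factor `1 - q^{2n+2}`
  -- cancels and the series is `q⁻¹` times `h2`, the case `e = 2`.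
  have h3 : HasSum (fun n : ℕ => qPoch (-q) (q ^ 2) (n + 1) * q ^ ((n : ℤ) ^ 2 - 2 * n) *
      (1 - (q ^ 2) ^ n) / (qPoch (q ^ 2) (q ^ 2) n * qPoch (q ^ 2) (q ^ 2) (n + 1)))
      (q⁻¹ * ((1 + q) * (1 + q ^ 3) *
        (qPochInf (-q) (q ^ 2) / qPochInf (q ^ 2) (q ^ 2)))) := by
    rw [← hasSum_nat_add_iff' 1]
    refine (h2.mul_left q⁻¹).congr_of_eq (fun n => ?_) (by simp)
    have h4 := one_sub_pow_ne_zero hQ n.succ_ne_zero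
    rw [show ((n + 1 : ℕ) : ℤ) ^ 2 - 2 * ((n + 1 : ℕ) : ℤ) = (-1) + ((n ^ 2 : ℕ) : ℤ) by
      push_cast; ring, zpow_add₀ hq0, zpow_neg_one, zpow_natCast, qPoch_self_succ (q ^ 2) n]
    rw [Nat.succ_eq_add_one] at h4
    have h5 := qPoch_ne_zero hQ hQ n
    have h6 := qPoch_ne_zero hQ hQ (n + 2)
    rw [show n + 1 + 1 = n + 2 by ring]
    field_simp
  refine ⟨hg.summable, (h1.add h3).congr_of_eq (fun n => ?_) ?_⟩
  · rw [← add_div]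
    congr 1
    rw [show ((n : ℤ) ^ 2 - 2 * n) = ((n ^ 2 : ℕ) : ℤ) - ((2 * n : ℕ) : ℤ) by push_cast; ring,
      zpow_sub₀ hq0, zpow_natCast, zpow_natCast]
    field_simp
    ring
  · rw [hg.tsum_eq]
    field_simp
    ring

/-! ### A false theta series -/

theorem qPoch_add (a q : ℂ) (j n : ℕ) :
    qPoch a q (j + n) = qPoch a q j * qPoch (a * q ^ j) q n := by
  rw [qPoch, Finset.prod_range_add]
  congr 1
  exact Finset.prod_congr rfl fun k _ => by ring

/-- The bound is uniform in `j` as well, because `1/(aq^j;q)_n = (a;q)_j (aq^{j+n};q)_∞/(a;q)_∞`.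
The remainders of the iterated recurrences below rely on this. -/
theorem exists_norm_inv_qPoch_le {a q : ℂ} (ha : ‖a‖ < 1) (hq : ‖q‖ < 1) :
    ∃ C : ℝ, 0 < C ∧ ∀ j n, ‖(qPoch (a * q ^ j) q n)⁻¹‖ ≤ C := by
  have h0 : 0 < ‖qPochInf a q‖ := norm_pos_iff.2 (qPochInf_ne_zero ha hq)
  set B := Real.exp (‖a‖ * (1 - ‖q‖)⁻¹) with hB
  refine ⟨B * (B / ‖qPochInf a q‖), by positivity, fun j n => ?_⟩
  have h1 := qPochInf_eq_qPoch_mul a hq (j + n)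
  have h2 := qPoch_ne_zero ha hq j
  have h3 : (qPoch (a * q ^ j) q n)⁻¹ =
      qPoch a q j * (qPochInf (a * q ^ (j + n)) q / qPochInf a q) := by
    have h4 : qPochInf a q ≠ 0 := qPochInf_ne_zero ha hq
    rw [h1, qPoch_add] at h4
    rw [h1, qPoch_add]
    have h5 := right_ne_zero_of_mul h4
    have h6 := right_ne_zero_of_mul (left_ne_zero_of_mul h4)
    field_simp
  rw [h3, norm_mul, norm_div]
  gcongr
  · exact norm_qPoch_le a hq j
  · refine norm_qPochInf_le_of_le ?_ hq
    rw [norm_mul]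
    exact mul_le_of_le_one_right (norm_nonneg a) (norm_pow_le_one hq _)

theorem eq_tsum_of_recurrence {x u v c : ℕ → ℂ} (hx : ∀ j, x j = u j + v j * x (j + 1))
    (hc0 : c 0 = 1) (hc : ∀ j, c (j + 1) = c j * v j) (hs : Summable fun j => c j * u j)
    (hlim : Tendsto (fun N => c N * x N) atTop (𝓝 0)) : x 0 = ∑' j, c j * u j := by
  have h : ∀ N, ∑ j ∈ Finset.range N, c j * u j = x 0 - c N * x N := by
    intro N
    induction N with
    | zero => simp [hc0]
    | succ N ih => rw [Finset.sum_range_succ, ih, hc, hx N]; ring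
  have h1 := hs.hasSum.tendsto_sum_nat
  simp only [h] at h1
  have h2 := (tendsto_const_nhds (x := x 0)).sub hlim
  rw [sub_zero] at h2
  exact tendsto_nhds_unique h2 h1

/-- The summand of `∑ (-1)^n q^{n²+n+4jn} / (q^{2j+1};q²)_{n+1}`. -/
noncomputable def falseThetaTerm (q : ℂ) (j n : ℕ) : ℂ :=
  (-1) ^ n * q ^ (n ^ 2 + n + 4 * j * n) / qPoch (q * (q ^ 2) ^ j) (q ^ 2) (n + 1)

theorem exists_norm_falseThetaTerm_le {q : ℂ} (hq : ‖q‖ < 1) :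
    ∃ C : ℝ, 0 < C ∧ ∀ j n, ‖falseThetaTerm q j n‖ ≤ C * ‖q‖ ^ n := by
  obtain ⟨C, hC, h⟩ := exists_norm_inv_qPoch_le hq (norm_pow_lt_one hq two_ne_zero)
  refine ⟨C, hC, fun j n => ?_⟩
  rw [falseThetaTerm, div_eq_mul_inv, norm_mul, norm_mul, norm_pow, norm_neg, norm_one, one_pow,
    one_mul, mul_comm, norm_pow]
  refine mul_le_mul (h _ _) (pow_le_pow_of_le_one (norm_nonneg q) hq.le ?_) (by positivity) hC.le
  rw [add_right_comm]
  exact Nat.le_add_left _ _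

theorem summable_falseThetaTerm {q : ℂ} (hq : ‖q‖ < 1) (j : ℕ) :
    Summable (falseThetaTerm q j) := by
  obtain ⟨C, -, h⟩ := exists_norm_falseThetaTerm_le hq
  exact Summable.of_norm_bounded
    ((summable_geometric_of_lt_one (norm_nonneg q) hq).mul_left C) (h j)

theorem exists_norm_tsum_le {f : ℕ → ℕ → ℂ} {q : ℂ} (hq : ‖q‖ < 1) {C : ℝ}
    (h : ∀ j n, ‖f j n‖ ≤ C * ‖q‖ ^ n) : ∃ B : ℝ, ∀ j, ‖∑' n, f j n‖ ≤ B :=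
  ⟨_, fun j => tsum_of_norm_bounded
    ((summable_geometric_of_lt_one (norm_nonneg q) hq).mul_left C).hasSum (h j)⟩

theorem norm_mul_pow_sq_lt {q : ℂ} (hq : ‖q‖ < 1) (j : ℕ) : ‖q * (q ^ 2) ^ j‖ < 1 := by
  rw [← pow_mul, ← pow_succ']
  exact norm_pow_lt_one hq (Nat.succ_ne_zero _)

/-- The right side telescopes in `n`, so summation links the series at `j` and `j + 1`. -/
theorem falseThetaTerm_recurrence {q : ℂ} (hq : ‖q‖ < 1) (j n : ℕ) :
    falseThetaTerm q j (n + 1) + q ^ (6 * j + 5) * falseThetaTerm q (j + 1) n =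
      q ^ (4 * j + 2) * (q ^ (2 * (n + 1)) * falseThetaTerm q j (n + 1) -
        q ^ (2 * n) * falseThetaTerm q j n) := by
  have hQ := norm_pow_lt_one hq two_ne_zero
  have hS := norm_mul_pow_sq_lt hq j
  have h1 := one_sub_ne_zero_of_norm_lt hS
  have h2 := qPoch_ne_zero (norm_mul_pow_sq_lt hq (j + 1)) hQ n
  have h2' := qPoch_ne_zero (norm_mul_pow_sq_lt hq (j + 1)) hQ (n + 1)
  simp only [falseThetaTerm]
  have e := qPoch_succ' (q * (q ^ 2) ^ j) (q ^ 2)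
  simp only [mul_assoc q, ← pow_succ] at e
  rw [e (n + 1), e n, qPoch_succ (q * (q ^ 2) ^ (j + 1))]
  rw [qPoch_succ] at h2'
  have h3 := right_ne_zero_of_mul h2'
  field_simp
  ring

theorem tsum_falseThetaTerm_recurrence {q : ℂ} (hq : ‖q‖ < 1) (j : ℕ) :
    ∑' n, falseThetaTerm q j n =
      (1 + q ^ (2 * j + 1)) + -q ^ (6 * j + 5) * ∑' n, falseThetaTerm q (j + 1) n := by
  have hs := summable_falseThetaTerm hq j
  have hs' := summable_falseThetaTerm hq (j + 1)
  have hR : Summable fun n => q ^ (2 * n) * falseThetaTerm q j n := by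
    refine Summable.of_norm_bounded hs.norm fun n => ?_
    rw [norm_mul]
    exact mul_le_of_le_one_left (norm_nonneg _) (norm_pow_le_one hq _)
  have h1 := ((summable_nat_add_iff 1).2 hs).tsum_add (hs'.mul_left (q ^ (6 * j + 5)))
  simp only [falseThetaTerm_recurrence hq] at h1
  rw [tsum_mul_left, ((summable_nat_add_iff 1).2 hR).tsum_sub hR, hR.tsum_eq_zero_add,
    tsum_mul_left] at h1
  have h2 : (1 - q ^ (2 * j + 1)) * falseThetaTerm q j 0 = 1 := by
    have h3 := one_sub_pow_ne_zero hq (2 * j).succ_ne_zero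
    have h4 : q * (q ^ 2) ^ j = q ^ (2 * j + 1) := by ring
    simp [falseThetaTerm, qPoch_succ, qPoch_zero, h4]
    field_simp
  rw [hs.tsum_eq_zero_add]
  simp only [mul_zero, pow_zero, one_mul] at h1
  linear_combination -h1 + (1 + q ^ (2 * j + 1)) * h2

theorem summable_neg_one_pow_mul {q : ℂ} (hq : ‖q‖ < 1) :
    Summable fun r : ℕ => (-1) ^ r * q ^ (3 * r ^ 2 + 2 * r) * (1 + q ^ (2 * r + 1)) := by
  refine Summable.of_norm_bounded
    ((summable_pow_of_le hq (f := fun r => 3 * r ^ 2 + 2 * r) fun n => by nlinarith).norm.mul_left 2)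
    fun r => ?_
  rw [norm_mul, norm_mul, norm_pow, norm_neg, norm_one, one_pow, one_mul, mul_comm]
  gcongr
  refine (norm_add_le _ _).trans ?_
  rw [norm_one]
  linarith [norm_pow_le_one hq (2 * r + 1)]

theorem tsum_falseThetaTerm_zero {q : ℂ} (hq : ‖q‖ < 1) :
    ∑' n, falseThetaTerm q 0 n =
      ∑' r : ℕ, (-1) ^ r * q ^ (3 * r ^ 2 + 2 * r) * (1 + q ^ (2 * r + 1)) := by
  obtain ⟨C, -, hC⟩ := exists_norm_falseThetaTerm_le hq
  obtain ⟨B, hB⟩ := exists_norm_tsum_le hq hC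
  refine eq_tsum_of_recurrence (x := fun j => ∑' n, falseThetaTerm q j n)
    (c := fun r => (-1) ^ r * q ^ (3 * r ^ 2 + 2 * r)) (tsum_falseThetaTerm_recurrence hq)
    (by simp) (fun j => by ring) (summable_neg_one_pow_mul hq) ?_
  refine squeeze_zero_norm (a := fun N => ‖q ^ (3 * N ^ 2 + 2 * N)‖ * B) (fun N => ?_) ?_
  · rw [norm_mul, norm_mul, norm_pow, norm_neg, norm_one, one_pow, one_mul]
    gcongr
    exact hB N
  · simpa using (summable_pow_of_le hq (f := fun r => 3 * r ^ 2 + 2 * r)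
      fun n => by nlinarith).tendsto_atTop_zero.norm.mul_const B

/-- The summand of `∑ q^{(2j+1)n} / (-q^{2j+1};q²)_{n+1}`. -/
noncomputable def fineTerm (q : ℂ) (j n : ℕ) : ℂ :=
  q ^ ((2 * j + 1) * n) / qPoch (-q * (q ^ 2) ^ j) (q ^ 2) (n + 1)

theorem exists_norm_fineTerm_le {q : ℂ} (hq : ‖q‖ < 1) :
    ∃ C : ℝ, 0 < C ∧ ∀ j n, ‖fineTerm q j n‖ ≤ C * ‖q‖ ^ n := by
  obtain ⟨C, hC, h⟩ := exists_norm_inv_qPoch_le (a := -q) (by rwa [norm_neg])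
    (norm_pow_lt_one hq two_ne_zero)
  refine ⟨C, hC, fun j n => ?_⟩
  rw [fineTerm, div_eq_mul_inv, norm_mul, mul_comm, norm_pow]
  refine mul_le_mul (h _ _) (pow_le_pow_of_le_one (norm_nonneg q) hq.le ?_) (by positivity) hC.le
  exact Nat.le_mul_of_pos_left n (Nat.succ_pos _)

theorem summable_fineTerm {q : ℂ} (hq : ‖q‖ < 1) (j : ℕ) : Summable (fineTerm q j) := by
  obtain ⟨C, -, h⟩ := exists_norm_fineTerm_le hq
  exact Summable.of_norm_bounded
    ((summable_geometric_of_lt_one (norm_nonneg q) hq).mul_left C) (h j)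

theorem norm_neg_mul_pow_sq_lt {q : ℂ} (hq : ‖q‖ < 1) (j : ℕ) : ‖-q * (q ^ 2) ^ j‖ < 1 := by
  rw [neg_mul, norm_neg]
  exact norm_mul_pow_sq_lt hq j

/-- With `x = q^{2j+1}`, both terms on the left carry `x^{n+1}`; subtracting the reciprocals of two
consecutive factorials yields the term at `j + 1`. -/
theorem fineTerm_recurrence {q : ℂ} (hq : ‖q‖ < 1) (j n : ℕ) :
    (1 + q ^ (2 * j + 1)) * (fineTerm q j (n + 1) - q ^ (2 * j + 1) * fineTerm q j n) =
      -q ^ (4 * j + 4) * fineTerm q (j + 1) n := by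
  have hQ := norm_pow_lt_one hq two_ne_zero
  have hS := norm_neg_mul_pow_sq_lt hq j
  have h1 := one_sub_ne_zero_of_norm_lt hS
  have h2' := qPoch_ne_zero (norm_neg_mul_pow_sq_lt hq (j + 1)) hQ (n + 1)
  simp only [fineTerm]
  have e := qPoch_succ' (-q * (q ^ 2) ^ j) (q ^ 2)
  simp only [mul_assoc (-q), ← pow_succ] at e
  rw [e (n + 1), e n, qPoch_succ (-q * (q ^ 2) ^ (j + 1))]
  rw [qPoch_succ] at h2'
  have h2 := left_ne_zero_of_mul h2'
  have h3 := right_ne_zero_of_mul h2'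
  simp only [neg_mul, sub_neg_eq_add] at h1 h2 h3 ⊢
  field_simp
  ring

theorem tsum_fineTerm_recurrence {q : ℂ} (hq : ‖q‖ < 1) (j : ℕ) :
    ∑' n, fineTerm q j n = (1 - (q ^ 2) ^ (2 * j + 1))⁻¹ +
      -((q ^ 2) ^ (2 * j + 2) * (1 - (q ^ 2) ^ (2 * j + 1))⁻¹) * ∑' n, fineTerm q (j + 1) n := by
  have hs := summable_fineTerm hq j
  have h1 := ((((summable_nat_add_iff 1).2 hs).tsum_sub (hs.mul_left (q ^ (2 * j + 1)))))
  have h2 := congrArg (fun z => (1 + q ^ (2 * j + 1)) * z) h1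
  simp only [← tsum_mul_left, fineTerm_recurrence hq] at h2
  simp only [tsum_mul_left] at h2
  have h3 : (1 + q ^ (2 * j + 1)) * fineTerm q j 0 = 1 := by
    have h4 := one_sub_ne_zero_of_norm_lt (norm_neg_mul_pow_sq_lt hq j)
    have h5 : -q * (q ^ 2) ^ j = -q ^ (2 * j + 1) := by ring
    rw [h5, sub_neg_eq_add] at h4
    simp only [fineTerm, qPoch_succ, qPoch_zero, h5, mul_zero, pow_zero, mul_one, one_mul,
      sub_neg_eq_add]
    field_simp
  have h6 := one_sub_pow_ne_zero (norm_pow_lt_one hq two_ne_zero) (2 * j).succ_ne_zero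
  rw [Nat.succ_eq_add_one] at h6
  rw [← mul_right_inj' h6, mul_add, mul_inv_cancel₀ h6,
    show ∀ X : ℂ, (1 - (q ^ 2) ^ (2 * j + 1)) *
      (-((q ^ 2) ^ (2 * j + 2) * (1 - (q ^ 2) ^ (2 * j + 1))⁻¹) * X) =
      -(q ^ 2) ^ (2 * j + 2) * X from fun X => by field_simp]
  have h7 := hs.tsum_eq_zero_add
  linear_combination -h2 + (1 + q ^ (2 * j + 1)) * h7 + h3

/-- Iterating the recurrence from `j = 0` accumulates the factors `-q^{4j+4}/(1-q^{4j+2})`, whose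
products are the false theta coefficients in base `q²`. -/
theorem tsum_fineTerm_zero {q : ℂ} (hq : ‖q‖ < 1) :
    ∑' n, fineTerm q 0 n = ∑' n, falseThetaTerm (q ^ 2) 0 n := by
  have hQ := norm_pow_lt_one hq two_ne_zero
  have hR := norm_pow_lt_one hQ two_ne_zero
  obtain ⟨C, -, hC⟩ := exists_norm_fineTerm_le hq
  obtain ⟨B, hB⟩ := exists_norm_tsum_le hq hC
  have hs := summable_falseThetaTerm hQ 0
  have hcu : ∀ n : ℕ, falseThetaTerm (q ^ 2) 0 n =
      (-1) ^ n * (q ^ 2) ^ (n ^ 2 + n) / qPoch (q ^ 2) ((q ^ 2) ^ 2) n *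
        (1 - (q ^ 2) ^ (2 * n + 1))⁻¹ := fun n => by
    have h1 := qPoch_ne_zero hQ hR n
    have h2 : 1 - (q ^ 2) ^ (2 * n + 1) ≠ 0 := one_sub_pow_ne_zero hQ (2 * n).succ_ne_zero
    rw [falseThetaTerm, pow_zero, mul_one, mul_zero, zero_mul, add_zero, qPoch_succ,
      ← pow_mul (q ^ 2) 2 n, ← pow_succ' (q ^ 2) (2 * n)]
    field_simp
  rw [tsum_congr hcu]
  refine eq_tsum_of_recurrence (x := fun j => ∑' n, fineTerm q j n)
    (tsum_fineTerm_recurrence hq) (by simp [qPoch_zero])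
    (fun j => ?_) (hs.congr hcu) ?_
  · rw [qPoch_succ, ← pow_mul (q ^ 2) 2 j, ← pow_succ' (q ^ 2) (2 * j)]
    have h1 := qPoch_ne_zero hQ hR j
    have h2 : 1 - (q ^ 2) ^ (2 * j + 1) ≠ 0 := one_sub_pow_ne_zero hQ (2 * j).succ_ne_zero
    field_simp
    ring
  · have h2 : ∀ N : ℕ, (-1) ^ N * (q ^ 2) ^ (N ^ 2 + N) / qPoch (q ^ 2) ((q ^ 2) ^ 2) N =
        falseThetaTerm (q ^ 2) 0 N * (1 - (q ^ 2) ^ (2 * N + 1)) := fun N => by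
      have h2 : 1 - (q ^ 2) ^ (2 * N + 1) ≠ 0 := one_sub_pow_ne_zero hQ (2 * N).succ_ne_zero
      rw [hcu, inv_mul_cancel_right₀ h2]
    refine squeeze_zero_norm (a := fun N => ‖falseThetaTerm (q ^ 2) 0 N‖ * 2 * B)
      (fun N => ?_) ?_
    · rw [h2, norm_mul, norm_mul]
      gcongr
      · refine (norm_sub_le _ _).trans ?_
        rw [norm_one]
        linarith [norm_pow_le_one hQ (2 * N + 1)]
      · exact hB N
    · simpa using (hs.tendsto_atTop_zero.norm.mul_const 2).mul_const B

/-! ### Euler's sum and the remaining identity -/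

theorem hasSum_euler {q : ℂ} (hq : ‖q‖ < 1) (k : ℕ) :
    HasSum (fun n : ℕ => q ^ (n ^ 2 + 2 * n) / qPoch (q ^ 2) (q ^ 2) n * q ^ (2 * k * n))
      (qPochInf (-q * (q ^ 2) ^ (k + 1)) (q ^ 2)) := by
  have hQ := norm_pow_lt_one hq two_ne_zero
  have h := (summable_qGaussTerm hQ (-q * (q ^ 2) ^ (k + 1)) 0).hasSum
  rw [tsum_qGaussTerm hQ] at h
  refine h.congr_of_eq (fun n => ?_) rfl
  have hw : qWeight (q ^ 2) (-q * (q ^ 2) ^ (k + 1)) 0 n = q ^ (n ^ 2 + 2 * n) * q ^ (2 * k * n) := by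
    induction n with
    | zero => simp [qWeight_zero]
    | succ n ih => rw [qWeight_succ, ih]; ring
  rw [qGaussTerm, hw, zero_mul, qPochInf_zero]
  ring

theorem hasSum_pow_div_qPoch_sq {q : ℂ} (hq : ‖q‖ < 1) :
    Summable (fun r : ℕ => (-1) ^ r * q ^ (6 * r ^ 2 + 4 * r) * (1 + q ^ (4 * r + 2))) ∧
      HasSum
        (fun n : ℕ => q ^ (n ^ 2 + 2 * n) /
          ((1 - q ^ (2 * n + 1)) * qPoch (q ^ 2) (q ^ 2) n))
        (qPochInf (-q) (q ^ 2) *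
          ∑' r : ℕ, (-1) ^ r * q ^ (6 * r ^ 2 + 4 * r) * (1 + q ^ (4 * r + 2))) := by
  have hQ := norm_pow_lt_one hq two_ne_zero
  have hq' : ‖-q‖ < 1 := by rwa [norm_neg]
  have he : ∀ r : ℕ, (-1) ^ r * q ^ (6 * r ^ 2 + 4 * r) * (1 + q ^ (4 * r + 2)) =
      (-1) ^ r * (q ^ 2) ^ (3 * r ^ 2 + 2 * r) * (1 + (q ^ 2) ^ (2 * r + 1)) := fun r => by ring
  simp only [he]
  refine ⟨summable_neg_one_pow_mul hQ, ?_⟩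
  rw [← tsum_falseThetaTerm_zero hQ, ← tsum_fineTerm_zero hq, ← tsum_mul_left]
  obtain ⟨C, hC, hCle⟩ := exists_norm_inv_qPoch_self_le hQ
  -- The double series with `1/(1-q^{2n+1})` expanded. Rows are geometric series; columns are Euler
  -- sums, giving `q^k (-q^{2k+3};q²)_∞ = (-q;q²)_∞ q^k/(-q;q²)_{k+1}`.
  let F : ℕ × ℕ → ℂ := fun p =>
    q ^ (p.1 ^ 2 + 2 * p.1) / qPoch (q ^ 2) (q ^ 2) p.1 * q ^ (p.2 * (2 * p.1 + 1))
  have hgeo := summable_geometric_of_lt_one (norm_nonneg q) hq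
  have hF : Summable F := by
    refine Summable.of_norm_bounded ((hgeo.mul_of_nonneg hgeo
      (fun n => by positivity) (fun n => by positivity)).mul_left C) fun p => ?_
    simp only [F]
    rw [norm_mul, div_eq_mul_inv, norm_mul, norm_pow, norm_pow, mul_comm (_ ^ _) ‖_‖, mul_assoc]
    have h1 : p.1 ≤ p.1 ^ 2 + 2 * p.1 := by nlinarith
    have h2 : p.2 ≤ p.2 * (2 * p.1 + 1) := Nat.le_mul_of_pos_right _ (Nat.succ_pos _)
    exact mul_le_mul (hCle _) (mul_le_mul (pow_le_pow_of_le_one (norm_nonneg q) hq.le h1)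
      (pow_le_pow_of_le_one (norm_nonneg q) hq.le h2) (by positivity) (by positivity))
      (by positivity) hC.le
  have h1 : HasSum (fun n : ℕ => q ^ (n ^ 2 + 2 * n) /
      ((1 - q ^ (2 * n + 1)) * qPoch (q ^ 2) (q ^ 2) n)) (∑' p, F p) := by
    refine (hF.hasSum.prod_fiberwise fun n => ((hasSum_geometric_of_norm_lt_one
      (norm_pow_lt_one hq (2 * n).succ_ne_zero)).mul_left
      (q ^ (n ^ 2 + 2 * n) / qPoch (q ^ 2) (q ^ 2) n)).congr_of_eq (fun k => ?_) rfl).congr_of_eq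
      (fun n => ?_) rfl
    · simp only [F]
      rw [← pow_mul, mul_comm k]
    · rw [Nat.succ_eq_add_one, div_mul_eq_div_div_swap, div_eq_mul_inv]
  have h2 : HasSum (fun k => qPochInf (-q) (q ^ 2) * fineTerm q 0 k) (∑' p, F p) := by
    refine (((Equiv.prodComm ℕ ℕ).hasSum_iff.2 hF.hasSum).prod_fiberwise
      fun k => ((hasSum_euler hq k).mul_left (q ^ k)).congr_of_eq (fun n => ?_) rfl).congr_of_eq
      (fun k => ?_) rfl
    · simp only [F, Function.comp_apply, Equiv.prodComm_apply, Prod.swap_prod_mk]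
      ring
    · have h3 := qPoch_ne_zero hq' hQ (k + 1)
      rw [qPochInf_eq_qPoch_mul (-q) hQ (k + 1), fineTerm, pow_zero, mul_one]
      field_simp
      ring
  rw [h2.tsum_eq]
  exact h1

theorem corollary3p10 (q : ℂ) (hq : ‖q‖ < 1) :
    -- first identity
    (Summable (fun r : ℕ => q ^ (8 * r ^ 2 + 4 * r + 1) * (1 - q ^ (8 * r + 4))) ∧
      HasSum
        (fun n : ℕ => qPoch (-q) (q ^ 2) n * q ^ (n ^ 2) /
          ((1 - q ^ (2 * n + 1)) * (qPoch (q ^ 2) (q ^ 2) n * qPoch (q ^ 2) (q ^ 2) n)))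
        (qPochInf (-q) (q ^ 2) / qPochInf (q ^ 2) (q ^ 2) *
          (1 + ∑' r : ℕ, q ^ (8 * r ^ 2 + 4 * r + 1) * (1 - q ^ (8 * r + 4))))) ∧
    -- second identity
    (Summable (fun r : ℕ => q ^ (6 * r ^ 2 + 2 * r) * (1 - q ^ (8 * r + 4))) ∧
      HasSum
        (fun n : ℕ => q ^ (n ^ 2 + n) /
          ((1 - q ^ (2 * n + 1)) * (qPoch q q n * qPoch q q n)))
        ((∑' r : ℕ, q ^ (6 * r ^ 2 + 2 * r) * (1 - q ^ (8 * r + 4))) / qPochInf q q)) ∧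
    -- third identity
    (Summable (fun r : ℕ => q ^ (6 * r ^ 2 + 4 * r) * (1 - q ^ (4 * r + 2))) ∧
      HasSum
        (fun n : ℕ => q ^ (n ^ 2 + 2 * n) /
          ((1 - q ^ (2 * n + 1)) * (qPoch q q n * qPoch q q n)))
        ((∑' r : ℕ, q ^ (6 * r ^ 2 + 4 * r) * (1 - q ^ (4 * r + 2))) / qPochInf q q)) ∧
    -- fourth identity (the division by 2 in the exponent is exact)
    (Summable (fun r : ℕ => q ^ (4 * r ^ 2 + r) * (1 - q ^ (6 * r + 3))) ∧
      HasSum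
        (fun n : ℕ => qPoch (-q) q n * q ^ ((n ^ 2 + n) / 2) /
          ((1 - q ^ (2 * n + 1)) * (qPoch q q n * qPoch q q n)))
        (qPochInf (-q) q / qPochInf q q *
          ∑' r : ℕ, q ^ (4 * r ^ 2 + r) * (1 - q ^ (6 * r + 3)))) ∧
    -- fifth identity (the division by 2 in the exponent is exact)
    (Summable (fun r : ℕ => q ^ (4 * r ^ 2 + 3 * r) * (1 - q ^ (2 * r + 1))) ∧
      HasSum
        (fun n : ℕ => qPoch (-q) q n * q ^ ((n ^ 2 + 3 * n) / 2) /
          ((1 - q ^ (2 * n + 1)) * (qPoch q q n * qPoch q q n)))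
        (qPochInf (-q) q / qPochInf q q *
          ∑' r : ℕ, q ^ (4 * r ^ 2 + 3 * r) * (1 - q ^ (2 * r + 1)))) ∧
    -- sixth identity
    (Summable (fun r : ℕ => (-1) ^ r * q ^ (6 * r ^ 2 + 4 * r) * (1 + q ^ (4 * r + 2))) ∧
      HasSum
        (fun n : ℕ => q ^ (n ^ 2 + 2 * n) /
          ((1 - q ^ (2 * n + 1)) * qPoch (q ^ 2) (q ^ 2) n))
        (qPochInf (-q) (q ^ 2) *
          ∑' r : ℕ, (-1) ^ r * q ^ (6 * r ^ 2 + 4 * r) * (1 + q ^ (4 * r + 2)))) ∧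
    -- seventh identity, which involves negative powers of `q`
    (q ≠ 0 →
      Summable (fun r : ℕ => q ^ (r ^ 2) * (q ^ (-(2 * r : ℤ)) - q ^ (2 * r))) ∧
      HasSum
        (fun n : ℕ => qPoch (-q) (q ^ 2) (n + 1) * q ^ ((n : ℤ) ^ 2 - 2 * n) /
          (qPoch (q ^ 2) (q ^ 2) n * qPoch (q ^ 2) (q ^ 2) (n + 1)))
        (qPochInf (-q) (q ^ 2) / qPochInf (q ^ 2) (q ^ 2) *
          (1 + q + q ^ 2 + q ^ 3 +
            ∑' r : ℕ, q ^ (r ^ 2) * (q ^ (-(2 * r : ℤ)) - q ^ (2 * r))))) := by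
  exact ⟨hasSum_qPoch_neg_sq_div hq, hasSum_pow_sq_add_self_div hq, hasSum_pow_sq_add_two_mul_div hq,
    hasSum_qPoch_neg_mul_pow_half_div hq, hasSum_qPoch_neg_mul_pow_half_add_div hq,
    hasSum_pow_div_qPoch_sq hq, hasSum_qPoch_neg_sq_succ_div hq⟩
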